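/- Let $I$ be an ideal of finite codimension in $\mathbb{C}[[x,y]]$ (that is, $\dim_{\mathbb C}\mathbb{C}[[x,y]]/I<\infty$), let $\mathfrak m=(x,y)$, and let $m(I)$ be the largest $k\in\mathbb N$ with $I\subseteq\mathfrak m^k$. Then the set $\mathcal D(I)$ of dicritical vertices of the Newton tree of $I$ is finite and $$m(I)=\sum_{v\in\mathcal D(I)}\rho(v)\,d_v .$$ The notions are the following, for a nonzero ideal $J\subseteq\mathbb{C}[[x,y]]$. *Faces.* Let $\Delta(J)\subseteq\mathbb R^2$ be the smallest convex set containing $E+\mathbb R_{\ge0}^2$, where $E\subseteq\mathbb N^2$ is the union of the supports of the elements of $J$. The faces of the Newton polygon of $J$ are the one-dimensional compact faces $S$ of $\Delta(J)$; the supporting line of $S$ has an equation $p_S\alpha+q_S\beta=N_S$ with $p_S,q_S\ge1$ coprime. The initial ideal $\mathrm{in}(J,S)$ is generated by the initial parts $\sum_{p_S\alpha+q_S\beta=N_S}c_{\alpha\beta}x^\alpha y^\beta$ of the elements $f=\sum c_{\alpha\beta}x^\alpha y^\beta$ of $J$. It can be written $$\mathrm{in}(J,S)=x^{a}y^{b}F_{J,S}(x^{q_S},y^{p_S})\bigl(k_1(x^{q_S},y^{p_S}),\dots,k_s(x^{q_S},y^{p_S})\bigr),$$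 where $F_{J,S}$ (the face polynomial) is homogeneous, monic in $y$ and divisible by neither $x$ nor $y$, and $k_1,\dots,k_s$ are coprime homogeneous polynomials of the same degree $d_S\ge0$. *Newton maps.* For coprime $p,q\ge1$ and $\mu\in\mathbb C^*$, let $p',q'\in\mathbb N$ be the unique numbers with $pp'-qq'=1$, $p'\le q$, $q'<p$. The Newton map $\sigma=\sigma_{(p,q,\mu)}$ is the endomorphism $f(x,y)\mapsto f\bigl(\mu^{q'}x^p,\,x^q(y+\mu^{p'})\bigr)$ of $\mathbb C[[x,y]]$, and $J_\sigma$ is the ideal generated by $\sigma(J)$. *Newton tree.* If $J=(x^k(y+h(x))^\nu)$ with $k,\nu\in\mathbb N$ and $h\in x\mathbb C[[x]]$, its Newton tree has no vertices. Otherwise its vertices are the faces $S$ of the Newton polygon of $J$ together with, for each such $S$ and each root $\mu$ of $F_{J,S}(1,\cdot)$, the vertices of the Newton tree of $J_\sigma$, $\sigma=\sigma_{(p_S,q_S,\mu)}$; the latter tree is attached to the vertex $S$. Thus each vertex $v$ of the Newton tree of $I$ is given by a sequence of such Newton maps $\sigma_{(p_1,q_1,\mu_1)},\dots,\sigma_{(p_n,q_n,\mu_n)}$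 ($n\ge0$), performed successively on $I$, and a face $S$ of the Newton polygon of the resulting ideal. Put $d_v=d_S$ and call $v$ dicritical if $d_v>0$. Finally, $$\rho(v)=\min\{p_1p_2\cdots p_n\,p_S,\ q_1p_2\cdots p_n\,p_S\}\ \text{ if } n\ge1,\qquad \rho(v)=\min\{p_S,q_S\}\ \text{ if } n=0 .$$ -/

import Mathlib

namespace NewtonTree

open MvPowerSeries

/-- The ring `ℂ[[x,y]]`, with `x = X 0` and `y = X 1`. -/
abbrev PS : Type := MvPowerSeries (Fin 2) ℂ

/-! ### Newton diagrams and faces -/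

/-- The union of the supports of the elements of `I`, as a set of exponents `(α, β) = (n 0, n 1)`. -/
def supp (I : Ideal PS) : Set (Fin 2 →₀ ℕ) :=
  {n | ∃ f ∈ I, coeff n f ≠ 0}

/-- The Newton diagram `Δ(E)`: the smallest convex set containing `E + ℝ₊²`. -/
def diagram (E : Set (Fin 2 →₀ ℕ)) : Set (ℝ × ℝ) :=
  convexHull ℝ {P | ∃ n ∈ E, ∃ b : ℝ × ℝ, 0 ≤ b.1 ∧ 0 ≤ b.2 ∧ P = ((n 0 : ℝ) + b.1, (n 1 : ℝ) + b.2)}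

/-- The line `p α + q β = N` in the plane with coordinates `(α, β)`. -/
@[ext] structure Line where
  p : ℕ
  q : ℕ
  N : ℕ

/-- `L` is, in normalized form, the supporting line of a face `S` of the Newton polygon of `I`,
that is, of a one-dimensional compact face of the Newton diagram `Δ(I)`: the line has positive
coprime coefficients, `Δ(I)` lies on one side of it, and the intersection `S` of `Δ(I)` with the
line has at least two points. A face is identified with its supporting line. -/
def IsFace (I : Ideal PS) (L : Line) : Prop :=
  0 < L.p ∧ 0 < L.q ∧ Nat.Coprime L.p L.q ∧
  (∀ P ∈ diagram (supp I), (L.N : ℝ) ≤ L.p * P.1 + L.q * P.2) ∧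
  {P ∈ diagram (supp I) | (L.p : ℝ) * P.1 + L.q * P.2 = L.N}.Nontrivial

/-- The initial part `in(f, L)`: the sum of the terms of `f` with exponents on the line `L`. -/
noncomputable def initialPart (L : Line) (f : PS) : PS :=
  fun n => if L.p * n 0 + L.q * n 1 = L.N then coeff n f else 0

/-- The initial ideal `in(I, S)`. -/
noncomputable def initialIdeal (I : Ideal PS) (L : Line) : Ideal PS :=
  Ideal.span (initialPart L '' (I : Set PS))

/-- `F` is the face polynomial and `d` the degree of the face with supporting line `L`:
`in(I, S) = x^a y^b F(x^q, y^p) (k₁(x^q, y^p), …, k_s(x^q, y^p))`,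
with `F` homogeneous, monic in `y`, not divisible by `x` or `y`, and `k₁, …, k_s` coprime and
homogeneous of the same degree `d`. The case of a principal initial ideal is `s = 1`, `k₁ = 1`,
and then `d = 0`. -/
def IsFaceData (I : Ideal PS) (L : Line) (F : MvPolynomial (Fin 2) ℂ) (d : ℕ) : Prop :=
  (∃ n : ℕ, F.IsHomogeneous n ∧ F.coeff (Finsupp.single 1 n) = 1) ∧
  ¬ MvPolynomial.X 0 ∣ F ∧ ¬ MvPolynomial.X 1 ∣ F ∧
  ∃ (a b s : ℕ) (k : Fin s → MvPolynomial (Fin 2) ℂ),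
    (∀ i, (k i).IsHomogeneous d) ∧
    (∀ g : MvPolynomial (Fin 2) ℂ, (∀ i, g ∣ k i) → IsUnit g) ∧
    initialIdeal I L = Ideal.span (Set.range fun i : Fin s =>
      (X 0 : PS) ^ a * (X 1 : PS) ^ b *
        MvPolynomial.aeval ![(X 0 : PS) ^ L.q, (X 1 : PS) ^ L.p] F *
        MvPolynomial.aeval ![(X 0 : PS) ^ L.q, (X 1 : PS) ^ L.p] (k i))

/-! ### Newton maps -/

/-- The data of a Newton map `σ_(p,q,μ)`. The numbers `p'`, `q'` are the unique natural numbers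
with `p p' - q q' = 1`, `p' ≤ q` and `q' < p`; the first equation forces `gcd(p,q) = 1`. -/
structure NewtonMap where
  p : ℕ
  q : ℕ
  μ : ℂ
  p' : ℕ
  q' : ℕ
  p_pos : 0 < p
  q_pos : 0 < q
  μ_ne_zero : μ ≠ 0
  bezout : p * p' = q * q' + 1
  p'_le : p' ≤ q
  q'_lt : q' < p

/-- The power series `μ^{q'} x^p` and `x^q (y + μ^{p'})` to be substituted for `x` and `y`. -/
noncomputable def NewtonMap.image (σ : NewtonMap) : Fin 2 → PS :=
  ![C (σ.μ ^ σ.q') * X 0 ^ σ.p, X 0 ^ σ.q * (X 1 + C (σ.μ ^ σ.p'))]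

theorem NewtonMap.hasSubst_image (σ : NewtonMap) : HasSubst σ.image := by
  apply hasSubst_of_constantCoeff_zero
  intro i
  have hp := σ.p_pos.ne'
  have hq := σ.q_pos.ne'
  fin_cases i <;> simp [NewtonMap.image, hp, hq]

/-- The Newton map `f(x,y) ↦ f(μ^{q'} x^p, x^q (y + μ^{p'}))`, an endomorphism of `ℂ[[x,y]]`. -/
noncomputable def NewtonMap.hom (σ : NewtonMap) : PS →ₐ[ℂ] PS :=
  substAlgHom σ.hasSubst_image

/-- The ideal `I_σ` generated by the image of `I` under the Newton map `σ`. -/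
noncomputable def NewtonMap.transform (σ : NewtonMap) (I : Ideal PS) : Ideal PS :=
  I.map σ.hom

/-! ### The Newton tree -/

/-- Depth zero: `I` is generated by `x^k (y + h(x))^ν` with `h ∈ x ℂ[[x]]`. -/
def IsDepthZero (I : Ideal PS) : Prop :=
  ∃ (k ν : ℕ) (h : PS), (∀ n : Fin 2 →₀ ℕ, n 1 ≠ 0 → coeff n h = 0) ∧
    constantCoeff h = 0 ∧ I = Ideal.span {(X 0 : PS) ^ k * (X 1 + h) ^ ν}

/-- `σ = σ_(p,q,μ)` is one of the Newton maps performed on `I`: `(p,q)` belongs to a face of the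
Newton polygon of `I`, and `μ` is a root of its face polynomial. -/
def IsStep (I : Ideal PS) (σ : NewtonMap) : Prop :=
  ∃ (N : ℕ) (F : MvPolynomial (Fin 2) ℂ) (d : ℕ),
    IsFace I ⟨σ.p, σ.q, N⟩ ∧ IsFaceData I ⟨σ.p, σ.q, N⟩ F d ∧ MvPolynomial.eval ![1, σ.μ] F = 0

/-- A vertex of the tree, specified by the sequence `Σ` of Newton maps that leads to it (empty for
a face of the Newton polygon of `I` itself), the corresponding face of the Newton polygon of
`I_Σ`, and the degree `d` of that face. -/
@[ext] structure Vertex where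
  path : List NewtonMap
  face : Line
  d : ℕ

/-- The Newton tree of `I` has a vertex that is reached by the sequence of Newton maps `Σ`, with
face `L` and degree `d`. An ideal of depth zero has no vertices. Otherwise there is one vertex for
each face of the Newton polygon of `I`, together with the vertices of the trees of the `I_σ`,
where `σ` runs through the Newton maps performed on `I`. -/
def HasVertex : Ideal PS → List NewtonMap → Line → ℕ → Prop
  | I, [], L, d => ¬ IsDepthZero I ∧ IsFace I L ∧ ∃ F, IsFaceData I L F d
  | I, σ :: l, L, d => ¬ IsDepthZero I ∧ IsStep I σ ∧ HasVertex (σ.transform I) l L d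

/-- The set of vertices of the Newton tree of `I`. -/
def vertices (I : Ideal PS) : Set Vertex :=
  {v | HasVertex I v.path v.face v.d}

/-- The set of dicritical vertices of the Newton tree of `I`. -/
def dicriticalVertices (I : Ideal PS) : Set Vertex :=
  {v ∈ vertices I | 0 < v.d}

/-- `ρ(v) = min {p_i p_{i-1} ⋯ p_1 p, q_i p_{i-1} ⋯ p_1 p}`, where `v_i, …, v_1, v` is the chain of
successive preceding vertices, starting on the Newton polygon of `I`. The vertex `v_i` carries
its unmodified decorations `(q_i, p_i)`, and the lower decoration `p` of a vertex is never
modified. -/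
def Vertex.rho (v : Vertex) : ℕ :=
  match v.path with
  | [] => min v.face.p v.face.q
  | σ :: l => min (σ.p * (l.map NewtonMap.p).prod * v.face.p)
      (σ.q * (l.map NewtonMap.p).prod * v.face.p)

end NewtonTree

namespace NewtonTree

/-! The proof computes two sizes of a Newton polygon from its faces and lets the tree split the
contribution of each face. A face S with face polynomial F_S and degree d_S consists of M_S = deg
F_S + d_S lattice steps (q_S, -p_S), because the space of initial parts along S is x^a y^b F_S times
a space of forms of degree d_S without common factor. Its vertical extent is therefore p_S M_S.

A Newton transform of a finite-codimensional ideal need not have finite codimension, but it only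
picks up a power of x. The induction thus runs over ideals x^k J' with x^n in J' (`IsRegular`),
whose height ν is the order in y of J' restricted to x = 0. For a root μ of F_S(1, ·), the transform
J_σ is again of this kind, and its height is exactly the multiplicity of μ
(`IsNormalForm.transform`, `IsRegular.transform`). Passing to the transform lowers (ν, n)
lexicographically (`IsRegular.transform_lt`), so the tree is finite.

Over ℂ the multiplicities of the roots add up to deg F_S. If the tree of J_σ contributes mult(μ),
then S and the trees attached to it contribute d_S + deg F_S = M_S, multiplied by whatever weight
g(p_S, q_S) the first face carries (`exists_dicriticalVertices`). For g = p the total Σ p_S M_S is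
the height ν, since the edges of the polygon stack up from height 0 to ν; this closes the induction
(`IsRegular.sum_prodP`). For g = min(p, q) the weight is ρ(v), and the total Σ min(p_S, q_S) M_S is
the order of I (`IsRegular.sum_min_eq`). For the latter, the shear (α, β) ↦ (α, α + β) turns the
order into the lowest height of a polygon whose edges are those with q < p, now of extent (p - q) M,
and min(p, q) = p - max(p - q, 0).

The face data are only asserted to exist, so two further facts are needed: every face has them
(`exists_isFaceData`), and the roots of the face polynomial and the degree are unique
(`IsFaceData.unique`). -/

/-! ### Compact edges of a set of lattice points -/

/-- `L` is, in normalized form, the line through a compact edge of the Newton polygon of the set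
`E` of lattice points. -/
def IsLatticeFace (E : Set (ℕ × ℕ)) (L : Line) : Prop :=
  0 < L.p ∧ 0 < L.q ∧ L.p.Coprime L.q ∧ (∀ e ∈ E, L.N ≤ L.p * e.1 + L.q * e.2) ∧
  ∃ l ∈ E, ∃ u ∈ E, L.p * l.1 + L.q * l.2 = L.N ∧ L.p * u.1 + L.q * u.2 = L.N ∧ l.2 < u.2

/-- Dickson's lemma: the minimal points form an antichain in a well-quasi-order. It makes extremal
choices over E finite. -/
theorem exists_finite_dominating (E : Set (ℕ × ℕ)) :
    ∃ S : Finset (ℕ × ℕ), (∀ e, e ∈ S ↔ Minimal (· ∈ E) e) ∧ ∀ e ∈ E, ∃ s ∈ S, s ≤ e := by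
  have hfin : {e | Minimal (· ∈ E) e}.Finite :=
    WellQuasiOrderedLE.finite_of_isAntichain (setOfPred_minimal_antichain (· ∈ E))
  refine ⟨hfin.toFinset, fun e => by simp, fun e he => ?_⟩
  obtain ⟨m, hm, hmin⟩ := exists_minimal_le_of_wellFoundedLT (· ∈ E) e he
  exact ⟨m, by simpa using hmin, hm⟩

/-- The abscissa at height `b - 1/2` of the line through `u` and `l`. -/
def crossing (b : ℕ) (u l : ℕ × ℕ) : ℚ :=
  (u.1 * ((b : ℚ) - 1 / 2 - l.2) + l.1 * (u.2 - ((b : ℚ) - 1 / 2))) / ((u.2 : ℚ) - l.2)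

/-- With l fixed, the crossing is an increasing function of the inverse slope seen from l, so
comparing crossings compares slopes: w lies on or to the right of the line through u and l. The
height b - 1/2 is never that of a lattice point, which keeps all denominators positive. -/
theorem slope_le_of_crossing_le_left {b : ℕ} {u w l : ℕ × ℕ} (hl : l.2 < b) (hu : b ≤ u.2)
    (hw : b ≤ w.2) (h : crossing b u l ≤ crossing b w l) :
    ((l.1 : ℤ) - u.1) * (l.2 - w.2) ≤ ((u.2 : ℤ) - l.2) * (w.1 - l.1) := by
  have hl' : (l.2 : ℚ) + 1 ≤ b := by exact_mod_cast hl
  have hu' : (b : ℚ) ≤ u.2 := by exact_mod_cast hu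
  have hw' : (b : ℚ) ≤ w.2 := by exact_mod_cast hw
  have key : ∀ v : ℕ × ℕ, (b : ℚ) ≤ v.2 → crossing b v l =
      l.1 + ((b : ℚ) - 1 / 2 - l.2) * (((v.1 : ℚ) - l.1) / (v.2 - l.2)) := by
    intro v hv
    have : (v.2 : ℚ) - l.2 ≠ 0 := by linarith
    rw [crossing]; field_simp; ring
  rw [key u hu', key w hw', add_le_add_iff_left,
    mul_le_mul_iff_right₀ (by linarith), div_le_div_iff₀ (by linarith) (by linarith)] at h
  have : ((l.1 : ℚ) - u.1) * (l.2 - w.2) ≤ ((u.2 : ℚ) - l.2) * (w.1 - l.1) := by linarith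
  exact_mod_cast this

theorem slope_le_of_crossing_le_right {b : ℕ} {u w l : ℕ × ℕ} (hl : l.2 < b) (hu : b ≤ u.2)
    (hw : w.2 < b) (h : crossing b u l ≤ crossing b u w) :
    ((l.1 : ℤ) - u.1) * (u.2 - w.2) ≤ ((u.2 : ℤ) - l.2) * (w.1 - u.1) := by
  have hl' : (l.2 : ℚ) + 1 ≤ b := by exact_mod_cast hl
  have hu' : (b : ℚ) ≤ u.2 := by exact_mod_cast hu
  have hw' : (w.2 : ℚ) + 1 ≤ b := by exact_mod_cast hw
  have key : ∀ v : ℕ × ℕ, (v.2 : ℚ) + 1 ≤ b → crossing b u v =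
      u.1 + ((u.2 : ℚ) - (b - 1 / 2)) * (((v.1 : ℚ) - u.1) / (u.2 - v.2)) := by
    intro v hv
    have : (u.2 : ℚ) - v.2 ≠ 0 := by linarith
    rw [crossing]; field_simp; ring
  rw [key l hl', key w hw', add_le_add_iff_left,
    mul_le_mul_iff_right₀ (by linarith), div_le_div_iff₀ (by linarith) (by linarith)] at h
  have : ((l.1 : ℚ) - u.1) * (u.2 - w.2) ≤ ((u.2 : ℚ) - l.2) * (w.1 - u.1) := by linarith
  exact_mod_cast this

/-- Among the segments from a minimal point of height at least b to one of height less than b, the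
one that meets the height b - 1/2 farthest to the left spans a supporting line: a point beyond that
line would give a segment crossing farther left. -/
theorem exists_latticeFace_crossing {E : Set (ℕ × ℕ)} {k ν b : ℕ} (hmem : (k, ν) ∈ E)
    (hmin : ∀ e ∈ E, k ≤ e.1 ∧ (e.1 = k → ν ≤ e.2)) {c : ℕ × ℕ} (hc : c ∈ E) (hcb : c.2 < b)
    (hb : b ≤ ν) :
    ∃ L, IsLatticeFace E L ∧ ∃ l ∈ E, ∃ u ∈ E, L.p * l.1 + L.q * l.2 = L.N ∧
      L.p * u.1 + L.q * u.2 = L.N ∧ l.2 < b ∧ b ≤ u.2 := by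
  obtain ⟨S, hS, hdom⟩ := exists_finite_dominating E
  have hkS : (k, ν) ∈ S := by
    refine (hS _).2 ⟨hmem, fun e he hle => ?_⟩
    have h1 := hmin e he
    have h2 : e.1 ≤ k := hle.1
    exact ⟨h1.1, h1.2 (le_antisymm h2 h1.1)⟩
  obtain ⟨c', hc'S, hc'⟩ := hdom c hc
  have hc'b : c'.2 < b := lt_of_le_of_lt hc'.2 hcb
  let T := (S.filter (b ≤ ·.2)) ×ˢ (S.filter (·.2 < b))
  have hT : T.Nonempty := ⟨((k, ν), c'), by simp [T, hkS, hb, hc'S, hc'b]⟩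
  obtain ⟨⟨u, l⟩, hul, hopt⟩ := Finset.exists_min_image T (fun x => crossing b x.1 x.2) hT
  simp only [T, Finset.mem_product, Finset.mem_filter] at hul hopt
  obtain ⟨⟨huS, hub⟩, hlS, hlb⟩ := hul
  have huE : u ∈ E := ((hS u).1 huS).1
  have hlE : l ∈ E := ((hS l).1 hlS).1
  have hkl : k < l.1 := by
    have := hmin l hlE
    by_contra hcon
    have := this.2 (by omega)
    omega
  have hku := (hmin u huE).1
  -- The normal of the line has positive entries: l lies strictly to the right of the column k, so
  -- if u were not to the left of l, then (k, ν) in place of u would cross farther left.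
  have hlu : u.1 < l.1 := by
    have h := slope_le_of_crossing_le_left (w := (k, ν)) hlb hub hb
      (hopt ((k, ν), l) ⟨⟨hkS, hb⟩, hlS, hlb⟩)
    by_contra hcon
    push Not at hcon
    simp only at h
    have h1 : ((u.2 : ℤ) - l.2) * (k - l.1) < 0 :=
      mul_neg_of_pos_of_neg (by omega) (by omega)
    have h2 : 0 ≤ ((l.1 : ℤ) - u.1) * (l.2 - ν) :=
      mul_nonneg_of_nonpos_of_nonpos (by omega) (by omega)
    omega
  have hsupp : ∀ w ∈ E, ((u.2 : ℤ) - l.2) * l.1 + ((l.1 : ℤ) - u.1) * l.2 ≤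
      ((u.2 : ℤ) - l.2) * w.1 + ((l.1 : ℤ) - u.1) * w.2 := by
    intro w hw
    obtain ⟨s, hsS, hsw⟩ := hdom w hw
    have hs : ((u.2 : ℤ) - l.2) * l.1 + ((l.1 : ℤ) - u.1) * l.2 ≤
        ((u.2 : ℤ) - l.2) * s.1 + ((l.1 : ℤ) - u.1) * s.2 := by
      rcases le_or_gt b s.2 with h | h
      · have := slope_le_of_crossing_le_left hlb hub h (hopt (s, l) ⟨⟨hsS, h⟩, hlS, hlb⟩)
        linarith
      · have := slope_le_of_crossing_le_right hlb hub h (hopt (u, s) ⟨⟨huS, hub⟩, hsS, h⟩)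
        linarith
    have h1 : (s.1 : ℤ) ≤ w.1 := by exact_mod_cast hsw.1
    have h2 : (s.2 : ℤ) ≤ w.2 := by exact_mod_cast hsw.2
    have h3 := mul_le_mul_of_nonneg_left h1 (show (0 : ℤ) ≤ (u.2 : ℤ) - l.2 by omega)
    have h4 := mul_le_mul_of_nonneg_left h2 (show (0 : ℤ) ≤ (l.1 : ℤ) - u.1 by omega)
    linarith
  obtain ⟨p₀, hp₀⟩ : ∃ p₀, u.2 = l.2 + p₀ := ⟨u.2 - l.2, by omega⟩
  obtain ⟨q₀, hq₀⟩ : ∃ q₀, l.1 = u.1 + q₀ := ⟨l.1 - u.1, by omega⟩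
  -- The coefficients of the line are the normal (u.2 - l.2, l.1 - u.1) divided by its gcd.
  obtain ⟨g, p, q, hg, hpq, hp, hq⟩ := Nat.exists_coprime' (m := p₀) (n := q₀)
    (Nat.gcd_pos_of_pos_left _ (by omega))
  have hp_pos : 0 < p := Nat.pos_of_ne_zero fun h => by simp [h] at hp; omega
  have hq_pos : 0 < q := Nat.pos_of_ne_zero fun h => by simp [h] at hq; omega
  have hu_on : p * u.1 + q * u.2 = p * l.1 + q * l.2 := by
    rw [hq₀, hp₀, hp, hq]; ring
  refine ⟨⟨p, q, p * l.1 + q * l.2⟩, ⟨hp_pos, hq_pos, hpq, fun e he => ?_, l, hlE, u, huE, rfl,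
    hu_on, by omega⟩, l, hlE, u, huE, rfl, hu_on, hlb, hub⟩
  have h := hsupp e he
  have e1 : (u.2 : ℤ) - l.2 = p * g := by rw [hp₀, hp]; push_cast; ring
  have e2 : (l.1 : ℤ) - u.1 = q * g := by rw [hq₀, hq]; push_cast; ring
  rw [e1, e2] at h
  have h5 : (g : ℤ) * (p * l.1 + q * l.2) ≤ g * (p * e.1 + q * e.2) := by linarith
  have := le_of_mul_le_mul_left h5 (by exact_mod_cast hg)
  exact_mod_cast this

/-- Convexity: steeper edges lie higher. Each line supports the point on the other one; eliminating
the abscissas from the two inequalities leaves (p q' - p' q)(u.2 - l.2) ≤ 0. -/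
theorem IsLatticeFace.le_of_slope_lt {E : Set (ℕ × ℕ)} {L L' : Line} (h : IsLatticeFace E L)
    (h' : IsLatticeFace E L') (hs : L'.p * L.q < L.p * L'.q) {l u : ℕ × ℕ}
    (hl : l ∈ E) (hu : u ∈ E) (hlL : L.p * l.1 + L.q * l.2 = L.N)
    (huL : L'.p * u.1 + L'.q * u.2 = L'.N) : u.2 ≤ l.2 := by
  have h1 := h.2.2.2.1 u hu
  have h2 := h'.2.2.2.1 l hl
  rw [← hlL] at h1
  rw [← huL] at h2
  have h3 := Nat.mul_le_mul_left L'.p h1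
  have h4 := Nat.mul_le_mul_left L.p h2
  by_contra hcon
  push Not at hcon
  zify at *
  nlinarith [mul_pos (sub_pos.2 hs) (sub_pos.2 hcon)]

theorem IsLatticeFace.eq_of_slope_eq {E : Set (ℕ × ℕ)} {L L' : Line} (h : IsLatticeFace E L)
    (h' : IsLatticeFace E L') (hs : L'.p * L.q = L.p * L'.q) : L = L' := by
  obtain ⟨hp, hq, hc, hle, l, hl, -, -, hlN, -⟩ := h
  obtain ⟨hp', hq', hc', hle', l', hl', -, -, hlN', -⟩ := h'
  have h1 : L.p = L'.p := Nat.dvd_antisymm (hc.dvd_of_dvd_mul_right (hs ▸ Dvd.intro _ rfl))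
    (hc'.dvd_of_dvd_mul_right (hs ▸ Dvd.intro _ rfl))
  have h2 : L.q = L'.q := by
    rw [h1] at hs
    exact Nat.eq_of_mul_eq_mul_left hp' hs
  refine Line.ext h1 h2 (le_antisymm ?_ ?_)
  · rw [← hlN', ← h1, ← h2]; exact hle l' hl'
  · rw [← hlN, h1, h2]; exact hle' l hl

/-- Edges of different slopes have height ranges that do not overlap, so only one edge passes
between the heights b - 1 and b. -/
theorem IsLatticeFace.eq_of_crossing {E : Set (ℕ × ℕ)} {L L' : Line} {b : ℕ}
    (h : IsLatticeFace E L) (h' : IsLatticeFace E L') {l u l' u' : ℕ × ℕ}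
    (hl : l ∈ E) (hu : u ∈ E) (hl' : l' ∈ E) (hu' : u' ∈ E)
    (hlL : L.p * l.1 + L.q * l.2 = L.N) (huL : L.p * u.1 + L.q * u.2 = L.N)
    (hlL' : L'.p * l'.1 + L'.q * l'.2 = L'.N) (huL' : L'.p * u'.1 + L'.q * u'.2 = L'.N)
    (hlb : l.2 < b) (hbu : b ≤ u.2) (hlb' : l'.2 < b) (hbu' : b ≤ u'.2) : L = L' := by
  rcases lt_trichotomy (L'.p * L.q) (L.p * L'.q) with hs | hs | hs
  · have := h.le_of_slope_lt h' hs hl hu' hlL huL'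
    omega
  · exact h.eq_of_slope_eq h' hs
  · have := h'.le_of_slope_lt h hs hl' hu hlL' huL
    omega

/-- A set of lattice points has finitely many compact edges, and their heights add up to the
height of the Newton polygon. -/
theorem exists_latticeFaces {E : Set (ℕ × ℕ)} {k ν m : ℕ} (hmem : (k, ν) ∈ E)
    (hmin : ∀ e ∈ E, k ≤ e.1 ∧ (e.1 = k → ν ≤ e.2)) (hm : ∃ c ∈ E, c.2 = m)
    (hm_le : ∀ e ∈ E, m ≤ e.2) :
    ∃ A : Finset Line, (∀ L, L ∈ A ↔ IsLatticeFace E L) ∧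
      ∀ h : Line → ℕ, (∀ L ∈ A, ∃ l ∈ E, ∃ u ∈ E, L.p * l.1 + L.q * l.2 = L.N ∧
        L.p * u.1 + L.q * u.2 = L.N ∧
        (∀ e ∈ E, L.p * e.1 + L.q * e.2 = L.N → l.2 ≤ e.2 ∧ e.2 ≤ u.2) ∧ u.2 = l.2 + h L) →
        ∑ L ∈ A, h L + m = ν := by
  classical
  obtain ⟨c, hc, hcm⟩ := hm
  -- Each unit interval [b - 1, b] between m and ν is assigned to the edge φ b that spans it; the
  -- line ⟨0, 0, 0⟩ outside this range is a dummy. Counting the fibres of φ then adds up the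
  -- heights.
  have hex : ∀ b : ℕ, ∃ L, m < b → b ≤ ν → IsLatticeFace E L ∧ ∃ l ∈ E, ∃ u ∈ E,
      L.p * l.1 + L.q * l.2 = L.N ∧ L.p * u.1 + L.q * u.2 = L.N ∧ l.2 < b ∧ b ≤ u.2 := by
    intro b
    by_cases hb : m < b ∧ b ≤ ν
    · obtain ⟨L, hL⟩ := exists_latticeFace_crossing hmem hmin hc (hcm ▸ hb.1) hb.2
      exact ⟨L, fun _ _ => hL⟩
    · exact ⟨⟨0, 0, 0⟩, fun h1 h2 => absurd ⟨h1, h2⟩ hb⟩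
  choose φ hφ using hex
  have hu_le : ∀ L, IsLatticeFace E L → ∀ u ∈ E, L.p * u.1 + L.q * u.2 = L.N → u.2 ≤ ν := by
    intro L hL u hu huL
    have h1 := hL.2.2.2.1 _ hmem
    simp only at h1
    rw [← huL] at h1
    have h2 := Nat.mul_le_mul_left L.p (hmin u hu).1
    have h3 : L.q * u.2 ≤ L.q * ν := by omega
    exact Nat.le_of_mul_le_mul_left h3 hL.2.1
  have huniq : ∀ L, IsLatticeFace E L → ∀ b l u, l ∈ E → u ∈ E → L.p * l.1 + L.q * l.2 = L.N →
      L.p * u.1 + L.q * u.2 = L.N → l.2 < b → b ≤ u.2 → φ b = L := by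
    intro L hL b l u hl hu hlL huL hlb hbu
    obtain ⟨h1, l', hl', u', hu', hlL', huL', hlb', hbu'⟩ :=
      hφ b (lt_of_le_of_lt (hm_le l hl) hlb) (hbu.trans (hu_le L hL u hu huL))
    exact h1.eq_of_crossing hL hl' hu' hl hu hlL' huL' hlL huL hlb' hbu' hlb hbu
  have hmν : m ≤ ν := hm_le _ hmem
  have hA : ∀ L, L ∈ (Finset.Ioc m ν).image φ ↔ IsLatticeFace E L := by
    intro L
    simp only [Finset.mem_image, Finset.mem_Ioc]
    constructor
    · rintro ⟨b, hb, rfl⟩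
      exact (hφ b hb.1 hb.2).1
    · intro hL
      obtain ⟨-, -, -, -, l, hl, u, hu, hlL, huL, hlu⟩ := id hL
      exact ⟨u.2, ⟨lt_of_le_of_lt (hm_le l hl) hlu, hu_le L hL u hu huL⟩,
        huniq L hL _ l u hl hu hlL huL hlu le_rfl⟩
  refine ⟨(Finset.Ioc m ν).image φ, hA, fun h hh => ?_⟩
  have hcard := Finset.card_eq_sum_card_image φ (Finset.Ioc m ν)
  rw [Nat.card_Ioc] at hcard
  suffices ∑ L ∈ (Finset.Ioc m ν).image φ, h L =
      ∑ L ∈ (Finset.Ioc m ν).image φ, ((Finset.Ioc m ν).filter (φ · = L)).card by omega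
  refine Finset.sum_congr rfl fun L hL => ?_
  obtain ⟨l, hl, u, hu, hlL, huL, hbd, hlu⟩ := hh L hL
  have hLf := (hA L).1 hL
  have : (Finset.Ioc m ν).filter (φ · = L) = Finset.Ioc l.2 u.2 := by
    ext b
    simp only [Finset.mem_filter, Finset.mem_Ioc]
    constructor
    · rintro ⟨hb, rfl⟩
      obtain ⟨-, l', hl', u', hu', hlL', huL', hlb', hbu'⟩ := hφ b hb.1 hb.2
      have h1 := hbd l' hl' hlL'
      have h2 := hbd u' hu' huL'
      omega
    · intro hb
      have h1 := hu_le L hLf u hu huL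
      have h2 := hm_le l hl
      exact ⟨by omega, huniq L hLf b l u hl hu hlL huL hb.1 hb.2⟩
  rw [this, Nat.card_Ioc]
  omega

/-! ### Exponents, supports and the lattice description of faces -/

open MvPowerSeries

/-- The exponent of the monomial `x^a y^b`. -/
noncomputable def pt (a b : ℕ) : Fin 2 →₀ ℕ := Finsupp.single 0 a + Finsupp.single 1 b

@[simp] theorem pt_zero (a b : ℕ) : pt a b 0 = a := by simp [pt]
@[simp] theorem pt_one (a b : ℕ) : pt a b 1 = b := by simp [pt]

@[simp] theorem pt_eta (n : Fin 2 →₀ ℕ) : pt (n 0) (n 1) = n := by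
  ext i; fin_cases i <;> simp

@[simp] theorem pt_inj {a b c d : ℕ} : pt a b = pt c d ↔ a = c ∧ b = d :=
  ⟨fun h => ⟨by simpa using DFunLike.congr_fun h 0, by simpa using DFunLike.congr_fun h 1⟩,
    fun h => by rw [h.1, h.2]⟩

theorem pt_eq_iff {a b : ℕ} {n : Fin 2 →₀ ℕ} : pt a b = n ↔ a = n 0 ∧ b = n 1 := by
  rw [← pt_eta n, pt_inj]; simp

/-- The support of an ideal as a set of lattice points. -/
def expo (I : Ideal PS) : Set (ℕ × ℕ) := {e | ∃ f ∈ I, coeff (pt e.1 e.2) f ≠ 0}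

theorem mem_supp_iff {I : Ideal PS} {n : Fin 2 →₀ ℕ} : n ∈ supp I ↔ (n 0, n 1) ∈ expo I := by
  simp [supp, expo]

theorem mem_expo_iff {I : Ideal PS} {e : ℕ × ℕ} : e ∈ expo I ↔ pt e.1 e.2 ∈ supp I := by
  simp [supp, expo]

theorem mem_diagram {I : Ideal PS} {e : ℕ × ℕ} (he : e ∈ expo I) :
    ((e.1 : ℝ), (e.2 : ℝ)) ∈ diagram (supp I) :=
  subset_convexHull _ _ ⟨pt e.1 e.2, mem_expo_iff.1 he, 0, by simp⟩

theorem diagram_subset {E : Set (Fin 2 →₀ ℕ)} {K : Set (ℝ × ℝ)} (hK : Convex ℝ K)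
    (h : ∀ n ∈ E, ∀ b c : ℝ, 0 ≤ b → 0 ≤ c → ((n 0 : ℝ) + b, (n 1 : ℝ) + c) ∈ K) :
    diagram E ⊆ K := by
  refine convexHull_min ?_ hK
  rintro P ⟨n, hn, b, hb, hc, rfl⟩
  exact h n hn _ _ hb hc

theorem convex_halfPlane_le (p q N : ℝ) : Convex ℝ {P : ℝ × ℝ | N ≤ p * P.1 + q * P.2} := by
  intro x hx y hy a b ha hb hab
  simp only [Set.mem_ofPred_eq, Prod.fst_add, Prod.snd_add, Prod.smul_fst, Prod.smul_snd,
    smul_eq_mul] at *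
  have : N = a * N + b * N := by rw [← add_mul, hab, one_mul]
  nlinarith [mul_le_mul_of_nonneg_left hx ha, mul_le_mul_of_nonneg_left hy hb]

/-- An open half-plane together with one boundary point is convex. It serves to show that a diagram
with at most one exponent on a supporting line meets that line in at most one point. -/
theorem convex_halfPlane_touching (p q N : ℝ) (Q : ℝ × ℝ) :
    Convex ℝ {P : ℝ × ℝ | N < p * P.1 + q * P.2 ∨ (N = p * P.1 + q * P.2 ∧ P = Q)} := by
  intro x hx y hy a b ha hb hab
  have hlin : p * (a • x + b • y).1 + q * (a • x + b • y).2 =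
      a * (p * x.1 + q * x.2) + b * (p * y.1 + q * y.2) := by
    simp only [Prod.fst_add, Prod.snd_add, Prod.smul_fst, Prod.smul_snd, smul_eq_mul]; ring
  have hN : N = a * N + b * N := by rw [← add_mul, hab, one_mul]
  rcases ha.eq_or_lt with rfl | ha
  · have : b = 1 := by linarith
    simpa [this] using hy
  rcases hb.eq_or_lt with rfl | hb
  · have : a = 1 := by linarith
    simpa [this] using hx
  rcases hx with hx | ⟨hx, rfl⟩
  · left
    rw [hlin, hN]
    have hy' : N ≤ p * y.1 + q * y.2 := by rcases hy with hy | hy <;> linarith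
    have := mul_lt_mul_of_pos_left hx ha
    have := mul_le_mul_of_nonneg_left hy' hb.le
    linarith
  · rcases hy with hy | ⟨hy, rfl⟩
    · left
      rw [hlin, hN]
      have := mul_lt_mul_of_pos_left hy hb
      rw [← hx]
      linarith
    · right
      rw [hlin, ← hx, ← hN]
      refine ⟨rfl, ?_⟩
      rw [← add_smul, hab, one_smul]

/-- Everything about faces is decided on the exponents: the convex hull adds nothing to the
supporting inequality, and it meets the line in two points only if two exponents lie there. -/
theorem isFace_iff {I : Ideal PS} {L : Line} : IsFace I L ↔ IsLatticeFace (expo I) L := by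
  unfold IsFace IsLatticeFace
  refine and_congr_right fun hp => and_congr_right fun hq => and_congr_right fun _ => ?_
  have hp' : (0 : ℝ) < L.p := by exact_mod_cast hp
  have hq' : (0 : ℝ) < L.q := by exact_mod_cast hq
  constructor
  · rintro ⟨hle, hnt⟩
    have hle' : ∀ e ∈ expo I, L.N ≤ L.p * e.1 + L.q * e.2 := fun e he => by
      have := hle _ (mem_diagram he)
      simp only at this
      exact_mod_cast this
    refine ⟨hle', ?_⟩
    by_contra hcon
    push Not at hcon
    have hsub : ∀ e ∈ expo I, ∀ e' ∈ expo I, L.p * e.1 + L.q * e.2 = L.N →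
        L.p * e'.1 + L.q * e'.2 = L.N → e = e' := by
      intro e he e' he' h h'
      have h2 : e.2 = e'.2 := le_antisymm (hcon e' he' e he h' h) (hcon e he e' he' h h')
      rw [h2] at h
      have h1 : L.p * e.1 = L.p * e'.1 := by omega
      exact Prod.ext (Nat.eq_of_mul_eq_mul_left hp h1) h2
    -- Q is the only exponent on the line; if there is none, any value will do.
    obtain ⟨Q, hQ⟩ : ∃ Q : ℝ × ℝ, ∀ e ∈ expo I, L.p * e.1 + L.q * e.2 = L.N →
        ((e.1 : ℝ), (e.2 : ℝ)) = Q := by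
      by_cases h : ∃ e ∈ expo I, L.p * e.1 + L.q * e.2 = L.N
      · obtain ⟨e, he, heN⟩ := h
        exact ⟨(e.1, e.2), fun e' he' h' => by rw [hsub e' he' e he h' heN]⟩
      · push Not at h
        exact ⟨0, fun e he h' => absurd h' (h e he)⟩
    have hK := diagram_subset (E := supp I) (convex_halfPlane_touching L.p L.q L.N Q) (by
      intro n hn b c hb hc
      have h1 := hle' _ (mem_supp_iff.1 hn)
      simp only [Set.mem_ofPred_eq]
      by_cases heq : L.p * n 0 + L.q * n 1 = L.N ∧ b = 0 ∧ c = 0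
      · right
        obtain ⟨h2, rfl, rfl⟩ := heq
        simp only [add_zero]
        exact ⟨by exact_mod_cast h2.symm, hQ _ (mem_supp_iff.1 hn) h2⟩
      · left
        have h1' : (L.N : ℝ) ≤ L.p * n 0 + L.q * n 1 := by exact_mod_cast h1
        by_contra hlt
        push Not at hlt
        have hb' := mul_nonneg hp'.le hb
        have hc' := mul_nonneg hq'.le hc
        have hb0 : (L.p : ℝ) * b = 0 := by linarith
        have hc0 : (L.q : ℝ) * c = 0 := by linarith
        refine heq ⟨?_, (mul_eq_zero.1 hb0).resolve_left hp'.ne',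
          (mul_eq_zero.1 hc0).resolve_left hq'.ne'⟩
        have : (L.p * n 0 + L.q * n 1 : ℝ) = L.N := by linarith
        exact_mod_cast this)
    obtain ⟨P, ⟨hP, hPN⟩, P', ⟨hP', hPN'⟩, hne⟩ := hnt
    have h1 := (hK hP).resolve_left (by linarith)
    have h2 := (hK hP').resolve_left (by linarith)
    exact hne (h1.2.trans h2.2.symm)
  · rintro ⟨hle, l, hl, u, hu, hlN, huN, hlu⟩
    refine ⟨fun P hP => diagram_subset (convex_halfPlane_le L.p L.q L.N) (fun n hn b c hb hc => ?_)
      hP, ((l.1 : ℝ), (l.2 : ℝ)), ⟨mem_diagram hl, by simp only; exact_mod_cast hlN⟩,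
      ((u.1 : ℝ), (u.2 : ℝ)), ⟨mem_diagram hu, by simp only; exact_mod_cast huN⟩, fun h => ?_⟩
    · have h1 : (L.N : ℝ) ≤ L.p * n 0 + L.q * n 1 := by
        exact_mod_cast hle _ (mem_supp_iff.1 hn)
      simp only [Set.mem_ofPred_eq]
      nlinarith [mul_nonneg hp'.le hb, mul_nonneg hq'.le hc]
    · have : (l.2 : ℝ) = u.2 := congrArg Prod.snd h
      have : l.2 = u.2 := by exact_mod_cast this
      omega

/-! ### Ideals of power series with prescribed vanishing coefficients -/

/-- The ideal of the power series whose coefficients at the exponents of a lower set vanish. -/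
def vanishingIdeal {U : Set (Fin 2 →₀ ℕ)} (hU : IsLowerSet U) : Ideal PS where
  carrier := {f | ∀ n ∈ U, coeff n f = 0}
  zero_mem' := fun n _ => by simp
  add_mem' := fun {f g} hf hg n hn => by rw [map_add, hf n hn, hg n hn, add_zero]
  smul_mem' := fun r f hf n hn => by
    classical
    rw [smul_eq_mul, coeff_mul]
    refine Finset.sum_eq_zero fun x hx => ?_
    rw [hf x.2 (hU (by rw [← Finset.HasAntidiagonal.mem_antidiagonal.1 hx]; exact le_add_self) hn), mul_zero]

theorem mem_vanishingIdeal {U : Set (Fin 2 →₀ ℕ)} {hU : IsLowerSet U} {f : PS} :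
    f ∈ vanishingIdeal hU ↔ ∀ n ∈ U, coeff n f = 0 := Iff.rfl

theorem isLowerSet_weight_lt (p q N : ℕ) : IsLowerSet {n : Fin 2 →₀ ℕ | p * n 0 + q * n 1 < N} :=
  fun a b hba (ha : p * a 0 + q * a 1 < N) => show p * b 0 + q * b 1 < N by
    have h0 := Nat.mul_le_mul_left p (hba 0)
    have h1 := Nat.mul_le_mul_left q (hba 1)
    omega

/-! ### Initial parts -/

theorem coeff_initialPart (L : Line) (f : PS) (n : Fin 2 →₀ ℕ) :
    coeff n (initialPart L f) = if L.p * n 0 + L.q * n 1 = L.N then coeff n f else 0 := rfl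

/-- The initial part as a linear map. -/
noncomputable def initialPartₗ (L : Line) : PS →ₗ[ℂ] PS where
  toFun := initialPart L
  map_add' f g := by ext n; simp only [coeff_initialPart, map_add]; split_ifs <;> simp
  map_smul' c f := by ext n; simp [coeff_initialPart]

@[simp] theorem initialPartₗ_apply (L : Line) (f : PS) : initialPartₗ L f = initialPart L f := rfl

/-- Nonconstant terms of r strictly increase the weight, and g has no terms below the line, so only
the constant term of r reaches the line. -/
theorem initialPart_mul {L : Line} (hp : 0 < L.p) (hq : 0 < L.q) (r : PS) {g : PS}
    (hg : ∀ n, L.p * n 0 + L.q * n 1 < L.N → coeff n g = 0) :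
    initialPart L (r * g) = constantCoeff r • initialPart L g := by
  classical
  ext n
  simp only [coeff_initialPart, coeff_smul]
  split_ifs with hn
  · rw [coeff_mul, Finset.sum_eq_single (0, n)]
    · simp
    · rintro ⟨x, y⟩ hxy hne
      have hadd := Finset.HasAntidiagonal.mem_antidiagonal.1 hxy
      simp only at hadd ⊢
      rw [hg y, mul_zero]
      have h0 : n 0 = x 0 + y 0 := by rw [← hadd]; rfl
      have h1 : n 1 = x 1 + y 1 := by rw [← hadd]; rfl
      rw [h0, h1] at hn
      have hx : x 0 ≠ 0 ∨ x 1 ≠ 0 := by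
        by_contra hcon
        push Not at hcon
        have hx0 : x = 0 := by ext i; fin_cases i <;> simp [hcon]
        apply hne
        rw [hx0, zero_add] at hadd
        rw [hx0, hadd]
      rcases hx with hx | hx
      · have := Nat.mul_pos hp (Nat.pos_of_ne_zero hx)
        nlinarith
      · have := Nat.mul_pos hq (Nat.pos_of_ne_zero hx)
        nlinarith
    · simp
  · simp

/-- The power series supported on the line `L`. -/
def IsOnLine (L : Line) (f : PS) : Prop := ∀ n, L.p * n 0 + L.q * n 1 ≠ L.N → coeff n f = 0

theorem IsOnLine.initialPart_eq {L : Line} {f : PS} (h : IsOnLine L f) : initialPart L f = f := by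
  ext n
  rw [coeff_initialPart]
  split_ifs with hn
  · rfl
  · rw [h n hn]

theorem isOnLine_initialPart (L : Line) (f : PS) : IsOnLine L (initialPart L f) := fun n hn => by
  rw [coeff_initialPart, if_neg hn]

theorem coeff_eq_zero_of_mem_span {L : Line} {S : Set PS} (hS : ∀ s ∈ S, IsOnLine L s) {g : PS}
    (hg : g ∈ Ideal.span S) {n : Fin 2 →₀ ℕ} (hn : L.p * n 0 + L.q * n 1 < L.N) :
    coeff n g = 0 :=
  (Ideal.span_le (I := vanishingIdeal (isLowerSet_weight_lt L.p L.q L.N))).2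
    (fun s hs _ hn => hS s hs _ (ne_of_lt hn)) hg n hn

/-- On the line, power series coefficients act through their constant terms, so ideal generation by
series on the line reduces to linear generation over ℂ. -/
theorem initialPart_mem_span {L : Line} (hp : 0 < L.p) (hq : 0 < L.q) {S : Set PS}
    (hS : ∀ s ∈ S, IsOnLine L s) {g : PS} (hg : g ∈ Ideal.span S) :
    initialPart L g ∈ Submodule.span ℂ S := by
  induction hg using Submodule.span_induction with
  | mem x hx => rw [(hS x hx).initialPart_eq]; exact Submodule.subset_span hx
  | zero => rw [← initialPartₗ_apply, map_zero]; exact zero_mem _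
  | add x y hx hy ihx ihy =>
    rw [← initialPartₗ_apply, map_add]; exact add_mem ihx ihy
  | smul r x hx ih =>
    rw [smul_eq_mul, initialPart_mul hp hq r fun n hn => coeff_eq_zero_of_mem_span hS hx hn]
    exact Submodule.smul_mem _ _ ih

/-- The space of the initial parts of the elements of `I`. -/
noncomputable def initialSpace (I : Ideal PS) (L : Line) : Submodule ℂ PS :=
  (I.restrictScalars ℂ).map (initialPartₗ L)

theorem initialIdeal_eq_span (I : Ideal PS) (L : Line) :
    initialIdeal I L = Ideal.span (initialSpace I L : Set PS) := rfl

theorem isOnLine_of_mem_initialSpace {I : Ideal PS} {L : Line} {g : PS}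
    (hg : g ∈ initialSpace I L) : IsOnLine L g := by
  obtain ⟨f, -, rfl⟩ := hg
  exact isOnLine_initialPart L f

/-- This trades the initial ideal for a vector space of polynomials, where face data become linear
algebra. -/
theorem initialSpace_eq_span {I : Ideal PS} {L : Line} (hp : 0 < L.p) (hq : 0 < L.q) {S : Set PS}
    (hS : ∀ s ∈ S, IsOnLine L s) (h : initialIdeal I L = Ideal.span S) :
    initialSpace I L = Submodule.span ℂ S := by
  rw [initialIdeal_eq_span] at h
  apply le_antisymm
  · intro v hv
    have h1 : v ∈ Ideal.span S := h ▸ Ideal.subset_span hv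
    have h2 := initialPart_mem_span hp hq hS h1
    rwa [(isOnLine_of_mem_initialSpace hv).initialPart_eq] at h2
  · rw [Submodule.span_le]
    intro s hs
    have h1 : s ∈ Ideal.span (initialSpace I L : Set PS) := h ▸ Ideal.subset_span hs
    have h2 := initialPart_mem_span hp hq (fun _ => isOnLine_of_mem_initialSpace) h1
    rwa [(hS s hs).initialPart_eq, Submodule.span_eq] at h2

/-! ### Homogeneous polynomials in two variables -/

/-- The dehomogenization `F ↦ F(1, t)`. -/
noncomputable def dehom : MvPolynomial (Fin 2) ℂ →ₐ[ℂ] Polynomial ℂ :=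
  MvPolynomial.aeval ![1, Polynomial.X]

/-- The homogeneous polynomial `F` of degree `D` with `F(1, t) = w`. -/
noncomputable def homog (D : ℕ) (w : Polynomial ℂ) : MvPolynomial (Fin 2) ℂ :=
  -- The swap makes x the homogenizing variable.
  MvPolynomial.rename (Equiv.swap 0 1) (w.homogenize D)

theorem homog_isHomogeneous (D : ℕ) (w : Polynomial ℂ) : (homog D w).IsHomogeneous D :=
  (Polynomial.isHomogeneous_homogenize w).rename_isHomogeneous

theorem dehom_homog {D : ℕ} {w : Polynomial ℂ} (hw : w.natDegree ≤ D) : dehom (homog D w) = w := by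
  rw [dehom, homog, MvPolynomial.aeval_rename, Polynomial.aeval_homogenize_of_eq_one hw _ (by simp)]
  simp

theorem homog_dehom {D : ℕ} {F : MvPolynomial (Fin 2) ℂ} (hF : F.IsHomogeneous D) :
    homog D (dehom F) = F := by
  have h := Polynomial.homogenize_eq_of_isHomogeneous (p := dehom F)
    (q := MvPolynomial.rename (Equiv.swap 0 1) F) hF.rename_isHomogeneous (by
      rw [dehom, MvPolynomial.aeval_rename]
      congr 2
      ext i; fin_cases i <;> simp)
  rw [homog, h, MvPolynomial.rename_rename, ← Equiv.coe_trans, Equiv.swap_swap]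
  simp

theorem homog_mul {m n : ℕ} {v w : Polynomial ℂ} (hv : v.natDegree ≤ m) (hw : w.natDegree ≤ n) :
    homog (m + n) (v * w) = homog m v * homog n w := by
  rw [homog, Polynomial.homogenize_mul _ _ hv hw, map_mul]; rfl

theorem homog_eq_sum (D : ℕ) (w : Polynomial ℂ) :
    homog D w = ∑ j ∈ Finset.range (D + 1), MvPolynomial.monomial (pt (D - j) j) (w.coeff j) := by
  rw [homog, Polynomial.homogenize, map_sum, Finset.Nat.sum_antidiagonal_eq_sum_range_succ_mk]
  refine Finset.sum_congr rfl fun j _ => ?_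
  rw [MvPolynomial.rename_monomial]
  refine congrArg (MvPolynomial.monomial · _) (pt_eq_iff.2 ⟨?_, ?_⟩).symm
  · rw [Finsupp.mapDomain_equiv_apply]; simp
  · rw [Finsupp.mapDomain_equiv_apply]; simp

theorem coeff_homog {D j : ℕ} (hj : j ≤ D) (w : Polynomial ℂ) :
    (homog D w).coeff (pt (D - j) j) = w.coeff j := by
  rw [homog_eq_sum, MvPolynomial.coeff_sum, Finset.sum_eq_single j]
  · simp
  · intro i _ hi
    rw [MvPolynomial.coeff_monomial, if_neg]
    rw [pt_inj]; omega
  · intro h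
    simp at h; omega

theorem coeff_dehom {D j : ℕ} {F : MvPolynomial (Fin 2) ℂ} (hF : F.IsHomogeneous D) (hj : j ≤ D) :
    (dehom F).coeff j = F.coeff (pt (D - j) j) := by
  rw [← coeff_homog hj, homog_dehom hF]

theorem natDegree_dehom_le {D : ℕ} {F : MvPolynomial (Fin 2) ℂ} (hF : F.IsHomogeneous D) :
    (dehom F).natDegree ≤ D := by
  have hD : dehom F = ∑ j ∈ Finset.range (D + 1), Polynomial.C (F.coeff (pt (D - j) j)) *
      Polynomial.X ^ j := by
    conv_lhs => rw [← homog_dehom hF, homog_eq_sum, map_sum]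
    refine Finset.sum_congr rfl fun j hj => ?_
    rw [coeff_dehom hF (by simp at hj; omega), dehom, MvPolynomial.aeval_monomial]
    simp [Finsupp.prod_fintype]
  rw [hD]
  refine Polynomial.natDegree_sum_le_of_forall_le _ _ fun j hj => ?_
  exact (Polynomial.natDegree_C_mul_X_pow_le _ _).trans (by simp at hj; omega)

theorem eval_dehom (F : MvPolynomial (Fin 2) ℂ) (μ : ℂ) :
    (dehom F).eval μ = MvPolynomial.eval ![1, μ] F := by
  have h : (Polynomial.aeval μ).comp dehom = MvPolynomial.aeval ![1, μ] := by
    ext i; fin_cases i <;> simp [dehom]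
  simpa [Polynomial.coe_aeval_eq_eval, MvPolynomial.coe_aeval_eq_eval] using DFunLike.congr_fun h F

theorem X_dvd_iff_coeff {i : Fin 2} {F : MvPolynomial (Fin 2) ℂ} :
    MvPolynomial.X i ∣ F ↔ ∀ n, n i = 0 → F.coeff n = 0 := by
  constructor
  · rintro ⟨G, rfl⟩ n hn
    rw [mul_comm, MvPolynomial.coeff_mul_X', if_neg (by simpa using hn)]
  · intro h
    rw [F.as_sum]
    refine Finset.dvd_sum fun n hn => MvPolynomial.X_dvd_monomial.2 (Or.inr fun h0 => ?_)
    exact MvPolynomial.mem_support_iff.1 hn (h n h0)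

theorem isHomogeneous_coeff_eq_zero {D : ℕ} {F : MvPolynomial (Fin 2) ℂ} (hF : F.IsHomogeneous D)
    {n : Fin 2 →₀ ℕ} (hn : n 0 + n 1 ≠ D) : F.coeff n = 0 :=
  hF.coeff_eq_zero (by rwa [Finsupp.degree_eq_sum, Fin.sum_univ_two])

theorem X_zero_dvd_iff {D : ℕ} {F : MvPolynomial (Fin 2) ℂ} (hF : F.IsHomogeneous D) :
    MvPolynomial.X 0 ∣ F ↔ (dehom F).coeff D = 0 := by
  rw [coeff_dehom hF le_rfl, X_dvd_iff_coeff]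
  refine ⟨fun h => h _ (by simp), fun h n hn => ?_⟩
  by_cases h1 : n 1 = D
  · rw [← h, tsub_self, ← pt_eta n, hn, h1]
  · exact isHomogeneous_coeff_eq_zero hF (by omega)

theorem X_one_dvd_iff {D : ℕ} {F : MvPolynomial (Fin 2) ℂ} (hF : F.IsHomogeneous D) :
    MvPolynomial.X 1 ∣ F ↔ (dehom F).coeff 0 = 0 := by
  rw [coeff_dehom hF (Nat.zero_le _), X_dvd_iff_coeff]
  refine ⟨fun h => h _ (by simp), fun h n hn => ?_⟩
  by_cases h1 : n 0 = D
  · rw [← h, tsub_zero, ← pt_eta n, hn, h1]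
  · exact isHomogeneous_coeff_eq_zero hF (by omega)

/-! ### Power series on a line -/

/-- The power series `x^a y^b W(x^q, y^p)`, where `W` is homogeneous of degree `D` and
`W(1, t) = w`. -/
noncomputable def lineSeries (a b p q D : ℕ) : Polynomial ℂ →ₗ[ℂ] PS :=
  ∑ j ∈ Finset.range (D + 1),
    (monomial (pt (a + q * (D - j)) (b + p * j))).comp (Polynomial.lcoeff ℂ j)

theorem lineSeries_apply (a b p q D : ℕ) (w : Polynomial ℂ) :
    lineSeries a b p q D w =
      ∑ j ∈ Finset.range (D + 1), monomial (pt (a + q * (D - j)) (b + p * j)) (w.coeff j) := by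
  simp [lineSeries]

theorem coeff_lineSeries {a b p q D j : ℕ} (hp : 0 < p) (hj : j ≤ D) (w : Polynomial ℂ) :
    coeff (pt (a + q * (D - j)) (b + p * j)) (lineSeries a b p q D w) = w.coeff j := by
  classical
  rw [lineSeries_apply, map_sum, Finset.sum_eq_single j]
  · simp
  · intro i _ hi
    rw [coeff_monomial, if_neg]
    rw [pt_inj]
    rintro ⟨-, h⟩
    exact hi (Nat.eq_of_mul_eq_mul_left hp (by omega)).symm
  · intro h
    simp at h; omega

theorem exists_of_coeff_lineSeries_ne_zero {a b p q D : ℕ} {w : Polynomial ℂ} {n : Fin 2 →₀ ℕ}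
    (h : coeff n (lineSeries a b p q D w) ≠ 0) :
    ∃ j ≤ D, n = pt (a + q * (D - j)) (b + p * j) := by
  classical
  rw [lineSeries_apply, map_sum] at h
  obtain ⟨j, hj, hne⟩ := Finset.exists_ne_zero_of_sum_ne_zero h
  rw [coeff_monomial] at hne
  exact ⟨j, by simp at hj; omega, by_contra fun h' => hne (if_neg h')⟩

theorem weight_lineSeries {a b p q D j : ℕ} (hj : j ≤ D) :
    p * (a + q * (D - j)) + q * (b + p * j) = p * a + q * b + p * q * D := by
  obtain ⟨i, rfl⟩ := Nat.exists_eq_add_of_le hj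
  rw [Nat.add_sub_cancel_left]; ring

theorem isOnLine_lineSeries (a b p q D : ℕ) (w : Polynomial ℂ) :
    IsOnLine ⟨p, q, p * a + q * b + p * q * D⟩ (lineSeries a b p q D w) := by
  intro n hn
  by_contra h
  obtain ⟨j, hj, rfl⟩ := exists_of_coeff_lineSeries_ne_zero h
  exact hn (by simpa using weight_lineSeries hj)

theorem monomial_pt (a b : ℕ) (c : ℂ) :
    (monomial (pt a b) c : PS) = C c * (X 0 ^ a * X 1 ^ b) := by
  rw [X_pow_eq, X_pow_eq, monomial_mul_monomial, mul_one, ← monomial_zero_eq_C_apply,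
    monomial_mul_monomial, mul_one, zero_add]
  rfl

theorem mul_aeval_eq_lineSeries {D : ℕ} {F : MvPolynomial (Fin 2) ℂ} (hF : F.IsHomogeneous D)
    (a b p q : ℕ) :
    (X 0 : PS) ^ a * X 1 ^ b * MvPolynomial.aeval ![(X 0 : PS) ^ q, X 1 ^ p] F =
      lineSeries a b p q D (dehom F) := by
  conv_lhs => rw [← homog_dehom hF, homog_eq_sum, map_sum, Finset.mul_sum]
  rw [lineSeries_apply]
  refine Finset.sum_congr rfl fun j _ => ?_
  rw [MvPolynomial.aeval_monomial, monomial_pt]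
  simp only [Finsupp.prod_fintype, pow_zero, implies_true, Fin.prod_univ_two, pt_zero, pt_one,
    Matrix.cons_val_zero, Matrix.cons_val_one]
  rw [show (algebraMap ℂ PS) (Polynomial.coeff (dehom F) j) = C ((dehom F).coeff j) from rfl]
  ring

/-- A description of the space of initial parts along `L`: it consists of the series
`x^a y^b (G w)(x^q, y^p)`, where `w` runs through a space `W` of polynomials of degree at most `d`,
and `G w` is homogenized in degree `deg G + d`. -/
structure IsNormalForm (I : Ideal PS) (L : Line) (a b d : ℕ) (G : Polynomial ℂ)
    (W : Submodule ℂ (Polynomial ℂ)) : Prop where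
  monic : G.Monic
  coeff_zero : G.coeff 0 ≠ 0
  natDegree_le : ∀ w ∈ W, w.natDegree ≤ d
  exists_eval_ne_zero : ∀ μ : ℂ, ∃ w ∈ W, w.eval μ ≠ 0
  exists_coeff_ne_zero : ∃ w ∈ W, w.coeff d ≠ 0
  weight_eq : L.N = L.p * a + L.q * b + L.p * L.q * (G.natDegree + d)
  mem_iff : ∀ f, f ∈ initialSpace I L ↔
    ∃ w ∈ W, lineSeries a b L.p L.q (G.natDegree + d) (G * w) = f

theorem lineSeries_ne_zero {a b p q D : ℕ} (hp : 0 < p) {w : Polynomial ℂ} (hw : w.natDegree ≤ D)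
    (h0 : w ≠ 0) : lineSeries a b p q D w ≠ 0 := by
  intro h
  apply h0
  ext j
  rcases le_or_gt j D with hj | hj
  · rw [← coeff_lineSeries (a := a) (b := b) (q := q) hp hj w, h]; simp
  · rw [Polynomial.coeff_eq_zero_of_natDegree_lt (by omega), Polynomial.coeff_zero]

theorem homog_X_sub_C_not_isUnit (μ : ℂ) :
    ¬ IsUnit (homog 1 (Polynomial.X - Polynomial.C μ)) := by
  intro h
  have h1 := h.map dehom
  rw [dehom_homog (by simp)] at h1
  exact Polynomial.not_isUnit_X_sub_C μ h1

theorem homog_X_sub_C_dvd {d : ℕ} {w : Polynomial ℂ} (hw : w.natDegree ≤ d) {μ : ℂ}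
    (h : w.eval μ = 0) : homog 1 (Polynomial.X - Polynomial.C μ) ∣ homog d w := by
  obtain ⟨u, rfl⟩ := Polynomial.dvd_iff_isRoot.2 h
  by_cases hu : u = 0
  · simp [hu, homog]
  · rw [Polynomial.natDegree_mul (Polynomial.X_sub_C_ne_zero μ) hu,
      Polynomial.natDegree_X_sub_C] at hw
    obtain ⟨e, rfl⟩ := Nat.exists_eq_add_of_le hw
    rw [show 1 + u.natDegree + e = 1 + (u.natDegree + e) by omega,
      homog_mul (by simp) (by omega)]
    exact Dvd.intro _ rfl

/-- Coprimality of the k_i is used through two consequences: the k_i(1, t) have no common root μ,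
since otherwise the form y - μx would divide them all, and x does not divide them all, so some
k_i(1, t) has degree exactly d. -/
theorem IsFaceData.exists_isNormalForm {I : Ideal PS} {L : Line} {F : MvPolynomial (Fin 2) ℂ}
    {d : ℕ} (hp : 0 < L.p) (hq : 0 < L.q) (h : IsFaceData I L F d) :
    ∃ a b W, IsNormalForm I L a b d (dehom F) W := by
  obtain ⟨⟨n, hF, hF1⟩, -, hX1, a, b, s, k, hk, hcop, hI⟩ := h
  have hFn : (dehom F).coeff n = 1 := by
    rw [coeff_dehom hF le_rfl, ← hF1]
    congr 1
    rw [pt_eq_iff]; simp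
  have hdeg : (dehom F).natDegree = n := le_antisymm (natDegree_dehom_le hF)
    (Polynomial.le_natDegree_of_ne_zero (by rw [hFn]; exact one_ne_zero))
  have hG : (dehom F).Monic := by rw [Polynomial.Monic, Polynomial.leadingCoeff, hdeg, hFn]
  have hev : ∀ μ : ℂ, ∃ i, (dehom (k i)).eval μ ≠ 0 := by
    intro μ
    by_contra hcon
    push Not at hcon
    refine homog_X_sub_C_not_isUnit μ (hcop _ fun i => ?_)
    rw [← homog_dehom (hk i)]
    exact homog_X_sub_C_dvd (natDegree_dehom_le (hk i)) (hcon i)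
  have htop : ∃ i, (dehom (k i)).coeff d ≠ 0 := by
    by_contra hcon
    push Not at hcon
    exact MvPolynomial.X_prime.not_isUnit (hcop (MvPolynomial.X 0) fun i =>
      (X_zero_dvd_iff (hk i)).2 (hcon i))
  set g : Fin s → PS := fun i => lineSeries a b L.p L.q (n + d) (dehom F * dehom (k i)) with hg
  have hI' : initialIdeal I L = Ideal.span (Set.range g) := by
    rw [hI]
    congr 2
    ext1 i
    rw [mul_assoc, ← map_mul, mul_aeval_eq_lineSeries (hF.mul (hk i)), map_mul]
  set N₀ := L.p * a + L.q * b + L.p * L.q * (n + d) with hN₀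
  have hline₀ : ∀ f ∈ Set.range g, IsOnLine ⟨L.p, L.q, N₀⟩ f := by
    rintro _ ⟨i, rfl⟩
    exact isOnLine_lineSeries _ _ _ _ _ _
  obtain ⟨i₀, hi₀⟩ := hev 0
  have hgi : g i₀ ≠ 0 := by
    have h1 : dehom (k i₀) ≠ 0 := fun h => hi₀ (by simp [h])
    refine lineSeries_ne_zero hp ?_ (mul_ne_zero hG.ne_zero h1)
    rw [hG.natDegree_mul' h1, hdeg]
    exact Nat.add_le_add_left (natDegree_dehom_le (hk i₀)) n
  have hmem : g i₀ ∈ Ideal.span (initialSpace I L : Set PS) := by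
    rw [← initialIdeal_eq_span, hI']
    exact Ideal.subset_span ⟨i₀, rfl⟩
  -- The face data do not mention N. A nonzero generator sits on the line of weight N₀ and lies in
  -- an ideal with no terms of weight below N; conversely, if N < N₀ then the initial space would
  -- vanish.
  have hN : L.N = N₀ := by
    apply le_antisymm
    · by_contra hlt
      push Not at hlt
      apply hgi
      ext m
      by_cases hm : L.p * m 0 + L.q * m 1 = N₀
      · exact coeff_eq_zero_of_mem_span (fun _ => isOnLine_of_mem_initialSpace) hmem
          (by rw [hm]; exact hlt)
      · exact hline₀ _ ⟨i₀, rfl⟩ m hm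
    · by_contra hlt
      push Not at hlt
      have hz : initialSpace I L = ⊥ := by
        rw [eq_bot_iff]
        intro v hv
        have h1 : v ∈ Ideal.span (Set.range g) := by
          rw [← hI', initialIdeal_eq_span]; exact Ideal.subset_span hv
        rw [Submodule.mem_bot]
        ext m
        by_cases hm : L.p * m 0 + L.q * m 1 = L.N
        · exact coeff_eq_zero_of_mem_span hline₀ h1 (by simpa [hm] using hlt)
        · exact isOnLine_of_mem_initialSpace hv m hm
      rw [hz] at hmem
      exact hgi (by simpa using hmem)
  have hL : (⟨L.p, L.q, N₀⟩ : Line) = L := by rw [← hN]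
  rw [hL] at hline₀
  have hspan := initialSpace_eq_span hp hq hline₀ hI'
  have hlin : Submodule.span ℂ (Set.range g) =
      (Submodule.span ℂ (Set.range fun i => dehom (k i))).map
        (lineSeries a b L.p L.q (n + d) ∘ₗ LinearMap.mulLeft ℂ (dehom F)) := by
    rw [Submodule.map_span, ← Set.range_comp]; rfl
  refine ⟨a, b, Submodule.span ℂ (Set.range fun i => dehom (k i)), ⟨hG,
    fun h0 => hX1 ((X_one_dvd_iff hF).2 h0), fun w hw => ?_, fun μ => ?_, ?_, ?_, fun f => ?_⟩⟩
  · have hle : Submodule.span ℂ (Set.range fun i => dehom (k i)) ≤ Polynomial.degreeLE ℂ d := by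
      rw [Submodule.span_le]
      rintro _ ⟨i, rfl⟩
      exact Polynomial.mem_degreeLE.2
        (Polynomial.natDegree_le_iff_degree_le.1 (natDegree_dehom_le (hk i)))
    exact Polynomial.natDegree_le_iff_degree_le.2 (Polynomial.mem_degreeLE.1 (hle hw))
  · obtain ⟨i, hi⟩ := hev μ
    exact ⟨_, Submodule.subset_span ⟨i, rfl⟩, hi⟩
  · obtain ⟨i, hi⟩ := htop
    exact ⟨_, Submodule.subset_span ⟨i, rfl⟩, hi⟩
  · rw [hdeg, hN]
  · rw [hspan, hlin, hdeg]
    rfl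

/-! ### The lattice points on a face -/

/-- The points of `E` on a face lie in the arithmetic progression of lattice points between two
extremal ones. -/
theorem IsLatticeFace.exists_extremal {E : Set (ℕ × ℕ)} {L : Line} (h : IsLatticeFace E L) :
    ∃ a b D, (a, b + L.p * D) ∈ E ∧ (a + L.q * D, b) ∈ E ∧
      L.N = L.p * a + L.q * b + L.p * L.q * D ∧
      ∀ e ∈ E, L.p * e.1 + L.q * e.2 = L.N → ∃ j ≤ D, e = (a + L.q * (D - j), b + L.p * j) := by
  obtain ⟨hp, hq, hc, hle, l', hl', u', hu', hlN', huN', hlu'⟩ := h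
  set S : Set (ℕ × ℕ) := {e ∈ E | L.p * e.1 + L.q * e.2 = L.N} with hS
  have hfin : S.Finite := by
    refine (Set.finite_Iic (L.N, L.N)).subset fun e he => ⟨?_, ?_⟩
    · have := Nat.le_mul_of_pos_left e.1 hp
      have := he.2
      show e.1 ≤ L.N
      omega
    · have := Nat.le_mul_of_pos_left e.2 hq
      have := he.2
      show e.2 ≤ L.N
      omega
  have hne : S.Nonempty := ⟨l', hl', hlN'⟩
  obtain ⟨l, ⟨hl, hlN⟩, hmin⟩ := Set.exists_min_image S Prod.snd hfin hne
  obtain ⟨u, ⟨hu, huN⟩, hmax⟩ := Set.exists_max_image S Prod.snd hfin hne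
  -- Since p and q are coprime, heights of lattice points on the line differ by multiples of p.
  have hstep : ∀ e : ℕ × ℕ, L.p * e.1 + L.q * e.2 = L.N → l.2 ≤ e.2 → ∃ j, e.2 = l.2 + L.p * j := by
    intro e heN hle
    obtain ⟨t, ht⟩ := Nat.exists_eq_add_of_le hle
    have : L.p ∣ L.q * t := by
      have h1 : L.p ∣ L.p * e.1 + L.q * t := by
        refine ⟨l.1, ?_⟩
        rw [ht, mul_add] at heN
        omega
      exact (Nat.dvd_add_right (Dvd.intro _ rfl)).1 h1
    obtain ⟨j, rfl⟩ := hc.dvd_of_dvd_mul_left this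
    exact ⟨j, ht⟩
  obtain ⟨D, hD⟩ := hstep u huN (hmin u ⟨hu, huN⟩)
  have hpos : ∀ e : ℕ × ℕ, L.p * e.1 + L.q * e.2 = L.N → ∀ j, e.2 = l.2 + L.p * j → j ≤ D →
      e.1 = u.1 + L.q * (D - j) := by
    intro e heN j hj hjD
    obtain ⟨i, rfl⟩ := Nat.exists_eq_add_of_le hjD
    rw [Nat.add_sub_cancel_left]
    refine Nat.eq_of_mul_eq_mul_left hp ?_
    rw [hj] at heN
    rw [hD] at huN
    linarith
  have hl1 : l.1 = u.1 + L.q * D := hpos l hlN 0 (by simp) (Nat.zero_le _)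
  refine ⟨u.1, l.2, D, ?_, ?_, ?_, fun e he heN => ?_⟩
  · rw [← hD]; exact hu
  · rw [← hl1]; exact hl
  · rw [← huN, hD]; ring
  · obtain ⟨j, hj⟩ := hstep e heN (hmin e ⟨he, heN⟩)
    have h1 : l.2 + L.p * j ≤ l.2 + L.p * D := by
      rw [← hj, ← hD]; exact hmax e ⟨he, heN⟩
    have hjD : j ≤ D := Nat.le_of_mul_le_mul_left (Nat.le_of_add_le_add_left h1) hp
    exact ⟨j, hjD, Prod.ext (hpos e heN j hj hjD) hj⟩

theorem mem_expo_of_initialSpace {I : Ideal PS} {L : Line} {f : PS} (hf : f ∈ initialSpace I L)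
    {a b : ℕ} (h : coeff (pt a b) f ≠ 0) : (a, b) ∈ expo I := by
  obtain ⟨g, hg, rfl⟩ := hf
  rw [initialPartₗ_apply, coeff_initialPart] at h
  exact ⟨g, hg, fun h0 => h (by simpa using fun _ => h0)⟩

/-- The vertical extent of a face in terms of its face polynomial and its degree. -/
theorem IsNormalForm.extent {I : Ideal PS} {L : Line} {a b d : ℕ} {G : Polynomial ℂ}
    {W : Submodule ℂ (Polynomial ℂ)} (hp : 0 < L.p) (h : IsNormalForm I L a b d G W) :
    (a, b + L.p * (G.natDegree + d)) ∈ expo I ∧ (a + L.q * (G.natDegree + d), b) ∈ expo I ∧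
      ∀ e ∈ expo I, L.p * e.1 + L.q * e.2 = L.N →
        ∃ j ≤ G.natDegree + d, e = (a + L.q * (G.natDegree + d - j), b + L.p * j) := by
  refine ⟨?_, ?_, ?_⟩
  · obtain ⟨w, hw, hwd⟩ := h.exists_coeff_ne_zero
    refine mem_expo_of_initialSpace ((h.mem_iff _).2 ⟨w, hw, rfl⟩) ?_
    have := coeff_lineSeries (a := a) (b := b) (q := L.q) hp (le_refl (G.natDegree + d)) (G * w)
    rw [tsub_self, mul_zero, add_zero] at this
    rw [this, Polynomial.coeff_mul_add_eq_of_natDegree_le le_rfl (h.natDegree_le w hw),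
      h.monic.coeff_natDegree, one_mul]
    exact hwd
  · obtain ⟨w, hw, hw0⟩ := h.exists_eval_ne_zero 0
    refine mem_expo_of_initialSpace ((h.mem_iff _).2 ⟨w, hw, rfl⟩) ?_
    have := coeff_lineSeries (a := a) (b := b) (q := L.q) hp (Nat.zero_le (G.natDegree + d)) (G * w)
    rw [mul_zero, add_zero, tsub_zero] at this
    rw [this, Polynomial.mul_coeff_zero]
    exact mul_ne_zero h.coeff_zero (by rwa [Polynomial.coeff_zero_eq_eval_zero])
  · rintro e ⟨f, hf, hfe⟩ heN
    obtain ⟨w, -, hwf⟩ := (h.mem_iff (initialPart L f)).1 ⟨f, hf, rfl⟩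
    have h1 : coeff (pt e.1 e.2) (initialPart L f) ≠ 0 := by
      rw [coeff_initialPart, if_pos (by simpa using heN)]; exact hfe
    rw [← hwf] at h1
    obtain ⟨j, hj, hej⟩ := exists_of_coeff_lineSeries_ne_zero h1
    rw [pt_inj] at hej
    exact ⟨j, hj, Prod.ext hej.1 hej.2⟩

/-! ### Existence of face data -/

/-- Homogenizing a Bézout identity Σ c_i κ_i = 1 shows that a common divisor divides a power of x;
the nonzero coefficient at t^d excludes x itself. -/
theorem isUnit_of_dvd_homog {s d : ℕ} {κ : Fin s → Polynomial ℂ} (hκ : ∀ i, (κ i).natDegree ≤ d)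
    (htop : ∃ i, (κ i).coeff d ≠ 0) (h1 : Ideal.span (Set.range κ) = ⊤)
    {g : MvPolynomial (Fin 2) ℂ} (hg : ∀ i, g ∣ homog d (κ i)) : IsUnit g := by
  have h2 : (1 : Polynomial ℂ) ∈ Ideal.span (Set.range κ) := h1 ▸ Submodule.mem_top
  obtain ⟨c, hc⟩ := Ideal.mem_span_range_iff_exists_fun.1 h2
  set r := Finset.univ.sup fun i => (c i).natDegree
  have hr : homog (r + d) 1 = ∑ i, homog r (c i) * homog d (κ i) := by
    rw [← hc, homog, Polynomial.homogenize_finsetSum, map_sum]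
    refine Finset.sum_congr rfl fun i hi => ?_
    exact homog_mul (Finset.le_sup (f := fun i => (c i).natDegree) hi) (hκ i)
  have hdvd : g ∣ MvPolynomial.X 0 ^ (r + d) := by
    have : homog (r + d) 1 = MvPolynomial.X 0 ^ (r + d) := by simp [homog]
    rw [← this, hr]
    exact Finset.dvd_sum fun i _ => (hg i).mul_left _
  obtain ⟨j, -, hj⟩ := (dvd_prime_pow MvPolynomial.X_prime _).1 hdvd
  rcases Nat.eq_zero_or_pos j with rfl | hj0
  · rw [pow_zero] at hj
    exact hj.symm.isUnit isUnit_one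
  · obtain ⟨i, hi⟩ := htop
    exfalso
    apply hi
    have h3 : MvPolynomial.X 0 ∣ homog d (κ i) :=
      ((dvd_pow_self _ hj0.ne').trans hj.symm.dvd).trans (hg i)
    rw [X_zero_dvd_iff (homog_isHomogeneous _ _), dehom_homog (hκ i)] at h3
    exact h3

theorem fg_of_natDegree_le {W : Submodule ℂ (Polynomial ℂ)} {d : ℕ}
    (hW : ∀ w ∈ W, w.natDegree ≤ d) : W.FG := by
  classical
  have hle : W ≤ Polynomial.degreeLE ℂ d := fun w hw =>
    Polynomial.mem_degreeLE.2 (Polynomial.natDegree_le_iff_degree_le.1 (hW w hw))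
  have : FiniteDimensional ℂ (Polynomial.degreeLE ℂ d) := by
    rw [Polynomial.degreeLE_eq_span_X_pow]
    infer_instance
  exact Module.Finite.iff_fg.1 (Submodule.finiteDimensional_of_le hle)

/-- Dehomogenized, the initial parts form a space W₀ of polynomials in t. The face polynomial is the
gcd G of W₀, and the k_i come from a finite generating family of W₀ / G. -/
theorem exists_isFaceData {I : Ideal PS} {L : Line} (h : IsFace I L) :
    ∃ F d, IsFaceData I L F d := by
  rw [isFace_iff] at h
  have hp := h.1
  obtain ⟨a, b, D, hu, hl, hN, hon⟩ := h.exists_extremal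
  -- φ reads off the coefficients of f at the lattice points of the face, numbered upwards from the
  -- lower end (a + qD, b).
  let φ : PS →ₗ[ℂ] Polynomial ℂ := ∑ j ∈ Finset.range (D + 1),
    (Polynomial.monomial j).comp (coeff (pt (a + L.q * (D - j)) (b + L.p * j)))
  have hφ : ∀ f, φ f = ∑ j ∈ Finset.range (D + 1),
      Polynomial.monomial j (coeff (pt (a + L.q * (D - j)) (b + L.p * j)) f) := by
    intro f; simp [φ]
  have hφc : ∀ f, ∀ j ≤ D, (φ f).coeff j = coeff (pt (a + L.q * (D - j)) (b + L.p * j)) f := by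
    intro f j hj
    rw [hφ, Polynomial.finsetSum_coeff, Finset.sum_eq_single j]
    · simp
    · intro i _ hi
      rw [Polynomial.coeff_monomial, if_neg hi]
    · intro h; simp at h; omega
  have hφd : ∀ f, (φ f).natDegree ≤ D := by
    intro f
    rw [hφ]
    exact Polynomial.natDegree_sum_le_of_forall_le _ _ fun j hj =>
      (Polynomial.natDegree_monomial_le _).trans (by simp at hj; omega)
  have hinit : ∀ f ∈ I, initialPart L f = lineSeries a b L.p L.q D (φ f) := by
    intro f hf
    have hlin := isOnLine_lineSeries a b L.p L.q D (φ f)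
    rw [← hN] at hlin
    ext n
    by_cases hn : L.p * n 0 + L.q * n 1 = L.N
    · rw [coeff_initialPart, if_pos hn]
      by_cases hnot : ∃ j ≤ D, n = pt (a + L.q * (D - j)) (b + L.p * j)
      · obtain ⟨j, hj, rfl⟩ := hnot
        rw [coeff_lineSeries hp hj, hφc f j hj]
      · have h1 : coeff n f = 0 := by
          by_contra hne
          obtain ⟨j, hj, hnj⟩ := hon (n 0, n 1) ⟨f, hf, by simpa using hne⟩ hn
          exact hnot ⟨j, hj, by rw [← pt_eta n, pt_inj]; exact Prod.ext_iff.1 hnj⟩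
        have h2 : coeff n (lineSeries a b L.p L.q D (φ f)) = 0 := by
          by_contra hne
          exact hnot (exists_of_coeff_lineSeries_ne_zero hne)
        rw [h1, h2]
    · rw [isOnLine_initialPart L f n hn, hlin n hn]
  set W₀ : Submodule ℂ (Polynomial ℂ) := (I.restrictScalars ℂ).map φ with hW₀
  have hspace : initialSpace I L = W₀.map (lineSeries a b L.p L.q D) := by
    ext g
    simp only [hW₀, initialSpace, Submodule.mem_map, Submodule.restrictScalars_mem]
    constructor
    · rintro ⟨f, hf, rfl⟩
      exact ⟨_, ⟨f, hf, rfl⟩, (hinit f hf).symm⟩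
    · rintro ⟨_, ⟨f, hf, rfl⟩, rfl⟩
      exact ⟨f, hf, hinit f hf⟩
  obtain ⟨w₀, hw₀, hw₀c⟩ : ∃ w ∈ W₀, w.coeff 0 ≠ 0 := by
    obtain ⟨f, hf, hfc⟩ := hl
    exact ⟨_, ⟨f, hf, rfl⟩, by rw [hφc f 0 (Nat.zero_le _)]; simpa using hfc⟩
  obtain ⟨w₁, hw₁, hw₁c⟩ : ∃ w ∈ W₀, w.coeff D ≠ 0 := by
    obtain ⟨f, hf, hfc⟩ := hu
    exact ⟨_, ⟨f, hf, rfl⟩, by rw [hφc f D le_rfl]; simpa using hfc⟩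
  have hw₁0 : w₁ ≠ 0 := fun h0 => hw₁c (by simp [h0])
  obtain ⟨G, hG, hGspan⟩ : ∃ G : Polynomial ℂ, G.Monic ∧
      Ideal.span (W₀ : Set (Polynomial ℂ)) = Ideal.span {G} := by
    obtain ⟨g, hg⟩ := (IsPrincipalIdealRing.principal (Ideal.span (W₀ : Set (Polynomial ℂ)))).1
    have hg0 : g ≠ 0 := by
      rintro rfl
      have h1 : w₁ ∈ Ideal.span (W₀ : Set (Polynomial ℂ)) := Ideal.subset_span hw₁
      rw [hg] at h1
      exact hw₁0 (by simpa using h1)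
    refine ⟨_, Polynomial.monic_mul_leadingCoeff_inv hg0, ?_⟩
    rw [hg, Ideal.submodule_span_eq, eq_comm]
    exact Ideal.span_singleton_mul_right_unit
      (Polynomial.isUnit_C.2 (IsUnit.mk0 _ (inv_ne_zero (by simpa using hg0)))) g
  have hGdvd : ∀ w ∈ W₀, ∃ v, w = G * v := fun w hw =>
    Ideal.mem_span_singleton.1 (hGspan ▸ Ideal.subset_span hw)
  -- These are the quotients of the elements of W₀ by G.
  set W : Submodule ℂ (Polynomial ℂ) := W₀.comap (LinearMap.mulLeft ℂ G) with hW
  have hGD : G.natDegree ≤ D := by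
    obtain ⟨v, hv⟩ := hGdvd w₁ hw₁
    have h1 : w₁.natDegree ≤ D := by
      obtain ⟨f, -, rfl⟩ := hw₁
      exact hφd f
    have hv0 : v ≠ 0 := fun h0 => hw₁0 (by rw [hv, h0, mul_zero])
    rw [hv, hG.natDegree_mul' hv0] at h1
    omega
  obtain ⟨d, rfl⟩ := Nat.exists_eq_add_of_le hGD
  have hWd : ∀ w ∈ W, w.natDegree ≤ d := by
    rintro w ⟨f, -, hf⟩
    by_cases hw0 : w = 0
    · simp [hw0]
    · have h1 := hφd f
      rw [hf, LinearMap.mulLeft_apply, hG.natDegree_mul' hw0] at h1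
      omega
  obtain ⟨s, κ, hκ⟩ := Submodule.fg_iff_exists_fin_generating_family.1 (fg_of_natDegree_le hWd)
  have hκW : ∀ i, κ i ∈ W := fun i => hκ ▸ Submodule.subset_span ⟨i, rfl⟩
  have hκd : ∀ i, (κ i).natDegree ≤ d := fun i => hWd _ (hκW i)
  have htop : ∃ i, (κ i).coeff d ≠ 0 := by
    by_contra hcon
    push Not at hcon
    have hle : W ≤ LinearMap.ker (Polynomial.lcoeff ℂ d) := by
      rw [← hκ, Submodule.span_le]
      rintro _ ⟨i, rfl⟩
      exact hcon i
    obtain ⟨v, rfl⟩ := hGdvd w₁ hw₁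
    have hv : v ∈ W := hw₁
    apply hw₁c
    rw [Polynomial.coeff_mul_add_eq_of_natDegree_le le_rfl (hWd v hv)]
    have : v.coeff d = 0 := hle hv
    rw [this, mul_zero]
  -- The gcd G lies in (G)(κ); cancelling G gives 1 ∈ (κ).
  have hone : Ideal.span (Set.range κ) = ⊤ := by
    rw [Ideal.eq_top_iff_one]
    have h1 : Ideal.span (W₀ : Set (Polynomial ℂ)) ≤ Ideal.span {G} * Ideal.span (Set.range κ) := by
      rw [Ideal.span_le]
      intro w hw
      obtain ⟨v, rfl⟩ := hGdvd w hw
      have hv : v ∈ W := hw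
      rw [← hκ] at hv
      exact Ideal.mul_mem_mul (Ideal.mem_span_singleton_self G)
        (Submodule.span_le_restrictScalars ℂ (Polynomial ℂ) _ hv)
    rw [hGspan] at h1
    obtain ⟨x, hx, hGx⟩ := Ideal.mem_span_singleton_mul.1 (h1 (Ideal.mem_span_singleton_self G))
    have : x = 1 := mul_left_cancel₀ hG.ne_zero (by rw [hGx, mul_one])
    rwa [← this]
  refine ⟨homog G.natDegree G, d, ⟨G.natDegree, homog_isHomogeneous _ _, ?_⟩, ?_, ?_, a, b, s,
    fun i => homog d (κ i), fun i => homog_isHomogeneous _ _,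
    fun g hg => isUnit_of_dvd_homog hκd htop hone hg, ?_⟩
  · rw [show Finsupp.single 1 G.natDegree = pt (G.natDegree - G.natDegree) G.natDegree by
      rw [eq_comm, pt_eq_iff]; simp, coeff_homog le_rfl]
    exact hG.coeff_natDegree
  · rw [X_zero_dvd_iff (homog_isHomogeneous _ _), dehom_homog le_rfl, hG.coeff_natDegree]
    exact one_ne_zero
  · rw [X_one_dvd_iff (homog_isHomogeneous _ _), dehom_homog le_rfl]
    intro h0
    obtain ⟨v, rfl⟩ := hGdvd w₀ hw₀
    exact hw₀c (by rw [Polynomial.mul_coeff_zero, h0, zero_mul])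
  · have hgen : ∀ i, (X 0 : PS) ^ a * (X 1 : PS) ^ b *
        MvPolynomial.aeval ![(X 0 : PS) ^ L.q, (X 1 : PS) ^ L.p] (homog G.natDegree G) *
        MvPolynomial.aeval ![(X 0 : PS) ^ L.q, (X 1 : PS) ^ L.p] (homog d (κ i)) =
        (lineSeries a b L.p L.q (G.natDegree + d) ∘ₗ LinearMap.mulLeft ℂ G) (κ i) := by
      intro i
      rw [mul_assoc, ← map_mul, mul_aeval_eq_lineSeries
        ((homog_isHomogeneous _ _).mul (homog_isHomogeneous _ _)), map_mul, dehom_homog le_rfl,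
        dehom_homog (hκd i)]
      rfl
    have hWW : W₀ = W.map (LinearMap.mulLeft ℂ G) := by
      rw [hW, Submodule.map_comap_eq, eq_comm, inf_eq_right]
      intro w hw
      obtain ⟨v, rfl⟩ := hGdvd w hw
      exact ⟨v, rfl⟩
    simp only [hgen]
    rw [initialIdeal_eq_span, hspace, hWW, ← Submodule.map_comp, ← hκ, Submodule.map_span,
      ← Set.range_comp]
    exact Submodule.span_span_of_tower _ _ _

/-! ### Newton maps on monomials and on initial parts -/

theorem coeff_X_pow_mul_aeval (m i j : ℕ) (c : ℂ) (w : Polynomial ℂ) :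
    coeff (pt i j) (C c * ((X 0 : PS) ^ m * Polynomial.aeval (X 1 : PS) w)) =
      if i = m then c * w.coeff j else 0 := by
  classical
  rw [coeff_C_mul]
  induction w using Polynomial.induction_on' with
  | add v w hv hw =>
    rw [map_add, mul_add, map_add, mul_add, hv, hw, Polynomial.coeff_add]
    split_ifs <;> ring
  | monomial k r =>
    rw [Polynomial.aeval_monomial, show (algebraMap ℂ PS) r = C r from rfl,
      show (X 0 : PS) ^ m * (C r * X 1 ^ k) = C r * (X 0 ^ m * X 1 ^ k) by ring, ← monomial_pt,
      coeff_monomial, Polynomial.coeff_monomial]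
    simp only [pt_inj]
    split_ifs <;> first | omega | simp

theorem NewtonMap.hom_X (σ : NewtonMap) (i : Fin 2) : σ.hom (X i) = σ.image i := by
  rw [NewtonMap.hom, substAlgHom_X]

/-- The image of `y` under a Newton map, without the power of `x`. -/
noncomputable def NewtonMap.shift (σ : NewtonMap) : Polynomial ℂ :=
  Polynomial.X + Polynomial.C (σ.μ ^ σ.p')

theorem NewtonMap.image_prod (σ : NewtonMap) (a b : ℕ) :
    σ.image 0 ^ a * σ.image 1 ^ b = C (σ.μ ^ (σ.q' * a)) *
      ((X 0 : PS) ^ (σ.p * a + σ.q * b) * Polynomial.aeval (X 1 : PS) (σ.shift ^ b)) := by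
  simp only [NewtonMap.image, NewtonMap.shift, Matrix.cons_val_zero, Matrix.cons_val_one, map_pow,
    map_add, Polynomial.aeval_X, Polynomial.aeval_C]
  rw [show (algebraMap ℂ PS) σ.μ = C σ.μ from rfl, mul_pow (X 0 ^ σ.q)]
  ring

theorem NewtonMap.coeff_hom (σ : NewtonMap) (f : PS) (i j : ℕ) :
    coeff (pt i j) (σ.hom f) = ∑ᶠ n : Fin 2 →₀ ℕ, coeff n f *
      if i = σ.p * n 0 + σ.q * n 1 then σ.μ ^ (σ.q' * n 0) * (σ.shift ^ n 1).coeff j else 0 := by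
  rw [NewtonMap.hom, substAlgHom_apply, coeff_subst σ.hasSubst_image]
  refine finsum_congr fun n => ?_
  rw [Finsupp.prod_fintype _ _ (fun _ => pow_zero _), Fin.prod_univ_two, σ.image_prod,
    coeff_X_pow_mul_aeval, smul_eq_mul]

theorem NewtonMap.hom_monomial (σ : NewtonMap) (a b : ℕ) (c : ℂ) :
    σ.hom (monomial (pt a b) c) = C (c * σ.μ ^ (σ.q' * a)) *
      ((X 0 : PS) ^ (σ.p * a + σ.q * b) * Polynomial.aeval (X 1 : PS) (σ.shift ^ b)) := by
  rw [monomial_pt, map_mul, map_mul, map_pow, map_pow, σ.hom_X, σ.hom_X, σ.image_prod,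
    show (C c : PS) = algebraMap ℂ PS c from rfl, AlgHom.commutes,
    show algebraMap ℂ PS c = C c from rfl, map_mul, mul_assoc]

/-- The polynomial `μ^(-q q') (t + μ^p')^p`, which takes the value `μ` at `0` to first order. -/
noncomputable def NewtonMap.root (σ : NewtonMap) : Polynomial ℂ :=
  Polynomial.C ((σ.μ ^ (σ.q * σ.q'))⁻¹) * σ.shift ^ σ.p

/-- The map sends x^q to μ^(qq') x^(pq) and y^p to x^(pq) (y + μ^p')^p, so the ratio y^p / x^q
becomes `root` evaluated at y, and a form in x^q and y^p becomes a monomial in x times w(`root`). -/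
theorem NewtonMap.hom_lineSeries (σ : NewtonMap) (a b : ℕ) {D : ℕ} {w : Polynomial ℂ}
    (hw : w.natDegree ≤ D) :
    σ.hom (lineSeries a b σ.p σ.q D w) = C (σ.μ ^ (σ.q' * (a + σ.q * D))) *
      ((X 0 : PS) ^ (σ.p * a + σ.q * b + σ.p * σ.q * D) *
        Polynomial.aeval (X 1 : PS) (σ.shift ^ b * w.comp σ.root)) := by
  rw [lineSeries_apply, map_sum, Polynomial.comp, Polynomial.eval₂_eq_sum_range' _
    (Nat.lt_succ_of_le hw), Finset.mul_sum, map_sum, Finset.mul_sum, Finset.mul_sum]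
  refine Finset.sum_congr rfl fun i hi => ?_
  have hiD : i ≤ D := by simp at hi; omega
  rw [σ.hom_monomial, weight_lineSeries hiD, NewtonMap.root, mul_pow, ← Polynomial.C_pow,
    show σ.shift ^ b * (Polynomial.C (w.coeff i) *
      (Polynomial.C ((σ.μ ^ (σ.q * σ.q'))⁻¹ ^ i) * (σ.shift ^ σ.p) ^ i)) =
      Polynomial.C (w.coeff i * (σ.μ ^ (σ.q * σ.q'))⁻¹ ^ i) * σ.shift ^ (b + σ.p * i) by
        rw [Polynomial.C_mul]; ring,
    map_mul (Polynomial.aeval _), Polynomial.aeval_C,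
    show ∀ r, algebraMap ℂ PS r = C r from fun _ => rfl,
    show w.coeff i * σ.μ ^ (σ.q' * (a + σ.q * (D - i))) =
      σ.μ ^ (σ.q' * (a + σ.q * D)) * (w.coeff i * (σ.μ ^ (σ.q * σ.q'))⁻¹ ^ i) by
        obtain ⟨e, rfl⟩ := Nat.exists_eq_add_of_le hiD
        have hμ := σ.μ_ne_zero
        rw [Nat.add_sub_cancel_left, inv_pow]
        field_simp
        ring,
    map_mul (C : ℂ →+* PS)]
  ring

theorem NewtonMap.shift_eval_zero (σ : NewtonMap) : σ.shift.eval 0 = σ.μ ^ σ.p' := by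
  simp [NewtonMap.shift]

theorem NewtonMap.root_eval_zero (σ : NewtonMap) : σ.root.eval 0 = σ.μ := by
  have hμ := σ.μ_ne_zero
  rw [NewtonMap.root, Polynomial.eval_mul, Polynomial.eval_C, Polynomial.eval_pow,
    σ.shift_eval_zero, ← pow_mul, mul_comm σ.p', σ.bezout, pow_succ]
  field_simp

/-- `root` takes the value μ at 0 because p p' = q q' + 1, and its derivative there is nonzero.
Composition with `root` hence preserves multiplicities. -/
theorem NewtonMap.root_sub_eq (σ : NewtonMap) :
    ∃ h : Polynomial ℂ, σ.root - Polynomial.C σ.μ = Polynomial.X * h ∧ h.eval 0 ≠ 0 := by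
  have hμ := σ.μ_ne_zero
  obtain ⟨h, hh⟩ : Polynomial.X ∣ σ.root - Polynomial.C σ.μ := by
    rw [Polynomial.X_dvd_iff, Polynomial.coeff_zero_eq_eval_zero, Polynomial.eval_sub,
      σ.root_eval_zero, Polynomial.eval_C, sub_self]
  refine ⟨h, hh, fun h0 => ?_⟩
  have h1 := congrArg (fun f => (Polynomial.derivative f).eval 0) hh
  simp only [Polynomial.derivative_sub, Polynomial.derivative_C, sub_zero,
    Polynomial.derivative_mul, Polynomial.derivative_X, one_mul, Polynomial.eval_add,
    Polynomial.eval_mul, Polynomial.eval_X, zero_mul, add_zero, h0, NewtonMap.root, zero_add,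
    Polynomial.derivative_pow, Polynomial.eval_C, Polynomial.eval_pow, σ.shift_eval_zero] at h1
  have hp : (σ.p : ℂ) ≠ 0 := by exact_mod_cast σ.p_pos.ne'
  have hd : (Polynomial.derivative σ.shift).eval 0 = 1 := by
    rw [NewtonMap.shift, Polynomial.derivative_add, Polynomial.derivative_X,
      Polynomial.derivative_C, add_zero, Polynomial.eval_one]
  rw [hd, mul_one] at h1
  exact mul_ne_zero (inv_ne_zero (pow_ne_zero _ hμ)) (mul_ne_zero hp (pow_ne_zero _
    (pow_ne_zero _ hμ))) h1

/-- The order at `0` of a polynomial composed with `root`. -/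
theorem NewtonMap.comp_root_eq (σ : NewtonMap) {G : Polynomial ℂ} (hG : G ≠ 0) :
    ∃ h : Polynomial ℂ, G.comp σ.root = Polynomial.X ^ (G.rootMultiplicity σ.μ) * h ∧
      h.eval 0 ≠ 0 := by
  obtain ⟨h₁, hh₁, hh₁0⟩ := σ.root_sub_eq
  obtain ⟨G₁, hG₁, hG₁0⟩ := Polynomial.exists_eq_pow_rootMultiplicity_mul_and_not_dvd G hG σ.μ
  refine ⟨h₁ ^ (G.rootMultiplicity σ.μ) * G₁.comp σ.root, ?_, ?_⟩
  · conv_lhs => rw [hG₁]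
    rw [Polynomial.mul_comp, Polynomial.pow_comp, Polynomial.sub_comp, Polynomial.X_comp,
      Polynomial.C_comp, hh₁, mul_pow, mul_assoc]
  · rw [Polynomial.eval_mul, Polynomial.eval_pow, Polynomial.eval_comp, σ.root_eval_zero]
    exact mul_ne_zero (pow_ne_zero _ hh₁0) fun h => hG₁0 (Polynomial.dvd_iff_isRoot.2 h)

/-! ### The leading part of the transform of an ideal -/

/-- The monomial x^α y^β is sent to x^(pα+qβ) times a polynomial in y, so only the terms on the line
contribute to x^N. -/
theorem NewtonMap.coeff_hom_initialPart (σ : NewtonMap) (f : PS) (N j : ℕ) :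
    coeff (pt N j) (σ.hom (initialPart ⟨σ.p, σ.q, N⟩ f)) = coeff (pt N j) (σ.hom f) := by
  rw [σ.coeff_hom, σ.coeff_hom]
  refine finsum_congr fun n => ?_
  rw [coeff_initialPart]
  simp only [eq_comm (a := N)]
  split_ifs <;> simp

theorem isLowerSet_lex (N m : ℕ) :
    IsLowerSet {n : Fin 2 →₀ ℕ | n 0 < N ∨ n 0 = N ∧ n 1 < m} :=
  fun a b hba (ha : a 0 < N ∨ a 0 = N ∧ a 1 < m) => show b 0 < N ∨ b 0 = N ∧ b 1 < m by
    have h0 := hba 0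
    have h1 := hba 1
    omega

/-- The lexicographically least exponent of the transform `I_σ` is `(N, m)`, where `m` is the
multiplicity of `μ` as a root of the face polynomial. -/
theorem IsNormalForm.transform {I : Ideal PS} {σ : NewtonMap} {N a b d : ℕ} {G : Polynomial ℂ}
    {W : Submodule ℂ (Polynomial ℂ)} (h : IsNormalForm I ⟨σ.p, σ.q, N⟩ a b d G W)
    (hN : ∀ e ∈ expo I, N ≤ σ.p * e.1 + σ.q * e.2) :
    (∀ g ∈ σ.transform I, ∀ n : Fin 2 →₀ ℕ,
      n 0 < N ∨ n 0 = N ∧ n 1 < G.rootMultiplicity σ.μ → coeff n g = 0) ∧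
    ∃ g ∈ σ.transform I, coeff (pt N (G.rootMultiplicity σ.μ)) g ≠ 0 := by
  set m := G.rootMultiplicity σ.μ with hm
  have hμ := σ.μ_ne_zero
  obtain ⟨v, hv, hv0⟩ := σ.comp_root_eq h.monic.ne_zero
  -- The coefficient of x^N is a polynomial in y, divisible by y^m because of G; the cofactor at 0
  -- is a nonzero constant times w(μ).
  have hcoeff : ∀ f, ∀ w ∈ W, initialPart ⟨σ.p, σ.q, N⟩ f =
      lineSeries a b σ.p σ.q (G.natDegree + d) (G * w) → ∀ j,
      coeff (pt N j) (σ.hom f) = σ.μ ^ (σ.q' * (a + σ.q * (G.natDegree + d))) *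
        (Polynomial.X ^ m * (σ.shift ^ b * v * w.comp σ.root)).coeff j := by
    intro f w hw hf j
    have hdeg : (G * w).natDegree ≤ G.natDegree + d :=
      Polynomial.natDegree_mul_le.trans (Nat.add_le_add_left (h.natDegree_le w hw) _)
    rw [← σ.coeff_hom_initialPart, hf, σ.hom_lineSeries a b hdeg, coeff_X_pow_mul_aeval,
      if_pos h.weight_eq, Polynomial.mul_comp, hv,
      show σ.shift ^ b * (Polynomial.X ^ m * v * w.comp σ.root) =
        Polynomial.X ^ m * (σ.shift ^ b * v * w.comp σ.root) by ring]
  constructor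
  · have hle : ∀ f ∈ I, σ.hom f ∈ vanishingIdeal (isLowerSet_lex N m) := by
      intro f hf n hn
      rw [← pt_eta n]
      rcases hn with hn | ⟨hn, hnm⟩
      · rw [σ.coeff_hom, finsum_eq_zero_of_forall_eq_zero]
        intro e
        split_ifs with he
        · have : coeff e f = 0 := by
            by_contra hne
            have := hN (e 0, e 1) ⟨f, hf, by simpa using hne⟩
            simp only at this
            omega
          rw [this, zero_mul]
        · rw [mul_zero]
      · obtain ⟨w, hw, hwf⟩ := (h.mem_iff (initialPart ⟨σ.p, σ.q, N⟩ f)).1 ⟨f, hf, rfl⟩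
        rw [hn, hcoeff f w hw hwf.symm, Polynomial.coeff_X_pow_mul', if_neg (by omega), mul_zero]
    have hle' : σ.transform I ≤ vanishingIdeal (isLowerSet_lex N m) := by
      rw [NewtonMap.transform, Ideal.map, Ideal.span_le]
      rintro _ ⟨f, hf, rfl⟩
      exact hle f hf
    intro g hg n hn
    exact mem_vanishingIdeal.1 (hle' hg) n hn
  · obtain ⟨w, hw, hwμ⟩ := h.exists_eval_ne_zero σ.μ
    obtain ⟨f, hf, hfw⟩ := (h.mem_iff _).2 ⟨w, hw, rfl⟩
    refine ⟨σ.hom f, Ideal.mem_map_of_mem _ hf, ?_⟩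
    rw [hcoeff f w hw hfw, Polynomial.coeff_X_pow_mul', if_pos le_rfl, tsub_self,
      Polynomial.coeff_zero_eq_eval_zero]
    simp only [Polynomial.eval_mul, Polynomial.eval_pow, Polynomial.eval_comp, σ.root_eval_zero,
      σ.shift_eval_zero]
    exact mul_ne_zero (pow_ne_zero _ hμ)
      (mul_ne_zero (mul_ne_zero (pow_ne_zero _ (pow_ne_zero _ hμ)) hv0) hwμ)

/-! ### Uniqueness of the face data -/

/-- The nonzero roots of the face polynomial with their multiplicities are determined by the
transforms of the ideal. -/
theorem IsNormalForm.rootMultiplicity_eq {I : Ideal PS} {σ : NewtonMap} {N a b d a' b' d' : ℕ}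
    {G G' : Polynomial ℂ} {W W' : Submodule ℂ (Polynomial ℂ)}
    (h : IsNormalForm I ⟨σ.p, σ.q, N⟩ a b d G W) (h' : IsNormalForm I ⟨σ.p, σ.q, N⟩ a' b' d' G' W')
    (hN : ∀ e ∈ expo I, N ≤ σ.p * e.1 + σ.q * e.2) :
    G.rootMultiplicity σ.μ = G'.rootMultiplicity σ.μ := by
  obtain ⟨h1, g, hg, hg0⟩ := h.transform hN
  obtain ⟨h1', g', hg', hg0'⟩ := h'.transform hN
  apply le_antisymm
  · by_contra hlt
    exact hg0' (h1 g' hg' _ (Or.inr (by simpa using hlt)))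
  · by_contra hlt
    exact hg0 (h1' g hg _ (Or.inr (by simpa using hlt)))

theorem exists_newtonMap {p q : ℕ} (hp : 0 < p) (hq : 0 < q) (hpq : p.Coprime q) {μ : ℂ}
    (hμ : μ ≠ 0) : ∃ σ : NewtonMap, σ.p = p ∧ σ.q = q ∧ σ.μ = μ := by
  obtain ⟨p', hp'q, q', hb⟩ : ∃ p' ≤ q, ∃ q', p * p' = q * q' + 1 := by
    rcases Nat.lt_or_ge 1 q with h1 | h1
    · obtain ⟨m, hm⟩ := Nat.exists_mul_mod_eq_one_of_coprime hpq h1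
      refine ⟨m, hm.1.le, p * m / q, ?_⟩
      have := Nat.div_add_mod (p * m) q
      omega
    -- There is no residue 1 modulo q = 1; here p' = q = 1, which the bound p' ≤ q allows.
    · obtain rfl : q = 1 := by omega
      exact ⟨1, le_rfl, p - 1, by omega⟩
  refine ⟨⟨p, q, μ, p', q', hp, hq, hμ, hb, hp'q, ?_⟩, rfl, rfl, rfl⟩
  have h1 : p * p' ≤ p * q := Nat.mul_le_mul_left p hp'q
  have h2 : q * q' < q * p := by rw [mul_comm q p]; omega
  exact Nat.lt_of_mul_lt_mul_left h2

theorem NewtonMap.coprime (σ : NewtonMap) : σ.p.Coprime σ.q := by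
  have h := σ.bezout
  have h1 : σ.p.gcd σ.q ∣ σ.q * σ.q' + 1 := h ▸ (Nat.gcd_dvd_left _ _).mul_right _
  exact Nat.dvd_one.1 ((Nat.dvd_add_right ((Nat.gcd_dvd_right σ.p σ.q).mul_right _)).1 h1)

/-- Two solutions p' differ by a multiple of q, and both lie in [1, q]. -/
theorem NewtonMap.p'_le_of_eq {σ τ : NewtonMap} (hp : σ.p = τ.p) (hq : σ.q = τ.q) :
    σ.p' ≤ τ.p' := by
  by_contra hlt
  push Not at hlt
  have h1 := σ.bezout
  have h2 := τ.bezout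
  rw [← hp, ← hq] at h2
  obtain ⟨t, ht⟩ := Nat.exists_eq_add_of_lt hlt
  have h3 : σ.q ∣ σ.p * (t + 1) := by
    have h4 : σ.p * (t + 1) + σ.q * τ.q' = σ.q * σ.q' := by
      rw [ht, show τ.p' + t + 1 = τ.p' + (t + 1) by ring, mul_add, h2] at h1
      omega
    exact (Nat.dvd_add_left (Dvd.intro _ rfl)).1 (h4 ▸ Dvd.intro _ rfl)
  have h5 := Nat.le_of_dvd (Nat.succ_pos t) (σ.coprime.symm.dvd_of_dvd_mul_left h3)
  have h6 := σ.p'_le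
  have h7 : τ.p' ≠ 0 := fun h0 => by rw [h0] at h2; omega
  omega

theorem NewtonMap.ext_of {σ τ : NewtonMap} (hp : σ.p = τ.p) (hq : σ.q = τ.q) (hμ : σ.μ = τ.μ) :
    σ = τ := by
  have hp' : σ.p' = τ.p' := le_antisymm (p'_le_of_eq hp hq) (p'_le_of_eq hp.symm hq.symm)
  have hq' : σ.q' = τ.q' := by
    have h1 := σ.bezout
    rw [hp, hp', τ.bezout, hq] at h1
    exact (Nat.eq_of_mul_eq_mul_left τ.q_pos (Nat.succ_injective h1)).symm
  cases σ; cases τ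
  simp only at hp hq hμ hp' hq'
  subst hp hq hμ hp' hq'
  rfl

/-! ### Uniqueness of the degree of a face -/

theorem IsNormalForm.length_le {I : Ideal PS} {L : Line} {a b d a' b' d' : ℕ}
    {G G' : Polynomial ℂ} {W W' : Submodule ℂ (Polynomial ℂ)} (hp : 0 < L.p)
    (h : IsNormalForm I L a b d G W) (h' : IsNormalForm I L a' b' d' G' W') :
    G.natDegree + d ≤ G'.natDegree + d' := by
  obtain ⟨hu, hl, -⟩ := h.extent hp
  obtain ⟨-, -, hon⟩ := h'.extent hp
  obtain ⟨j, hj, hj'⟩ := hon _ hu (by rw [h.weight_eq]; ring)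
  obtain ⟨i, -, hi'⟩ := hon _ hl (by rw [h.weight_eq]; ring)
  have h1 : b + L.p * (G.natDegree + d) = b' + L.p * j := congrArg Prod.snd hj'
  have h2 : b = b' + L.p * i := congrArg Prod.snd hi'
  have h3 : L.p * (G.natDegree + d) ≤ L.p * j := by omega
  exact (Nat.le_of_mul_le_mul_left h3 hp).trans hj

/-- Root multiplicities are read off from the transforms of I, which do not involve the face data.
They determine deg F over ℂ, and deg F + d is the lattice length of the face. -/
theorem IsFaceData.unique {I : Ideal PS} {L : Line} {F F' : MvPolynomial (Fin 2) ℂ} {d d' : ℕ}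
    (hL : IsFace I L) (h : IsFaceData I L F d) (h' : IsFaceData I L F' d') :
    (dehom F).roots = (dehom F').roots ∧ d = d' := by
  obtain ⟨hp, hq, hc, hN, -⟩ := isFace_iff.1 hL
  obtain ⟨a, b, W, hn⟩ := h.exists_isNormalForm hp hq
  obtain ⟨a', b', W', hn'⟩ := h'.exists_isNormalForm hp hq
  have hroots : (dehom F).roots = (dehom F').roots := by
    ext μ
    rw [Polynomial.count_roots, Polynomial.count_roots]
    by_cases hμ : μ = 0
    · subst hμ
      rw [Polynomial.rootMultiplicity_eq_zero, Polynomial.rootMultiplicity_eq_zero]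
      · rw [Polynomial.IsRoot, ← Polynomial.coeff_zero_eq_eval_zero]
        exact hn'.coeff_zero
      · rw [Polynomial.IsRoot, ← Polynomial.coeff_zero_eq_eval_zero]
        exact hn.coeff_zero
    · obtain ⟨σ, hσp, hσq, rfl⟩ := exists_newtonMap hp hq hc hμ
      have hσL : L = ⟨σ.p, σ.q, L.N⟩ := Line.ext hσp.symm hσq.symm rfl
      rw [hσL] at hn hn'
      refine hn.rootMultiplicity_eq hn' ?_
      rw [hσp, hσq]
      exact hN
  have hdeg : (dehom F).natDegree = (dehom F').natDegree := by
    rw [← IsAlgClosed.card_roots_eq_natDegree, hroots, IsAlgClosed.card_roots_eq_natDegree]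
  have h1 := hn.length_le hp hn'
  have h2 := hn'.length_le hp hn
  exact ⟨hroots, by omega⟩

/-! ### Ideals that are of finite codimension up to a power of `x` -/

/-- The ideal `J` is `x^k J'`, where `J'` contains `x^n` and the least order in `y` of the
elements of `J'` restricted to `x = 0` is `ν`. -/
structure IsRegular (J : Ideal PS) (k ν n : ℕ) : Prop where
  coeff_eq_zero : ∀ f ∈ J, ∀ m : Fin 2 →₀ ℕ, m 0 < k ∨ m 0 = k ∧ m 1 < ν → coeff m f = 0
  mem_expo : (k, ν) ∈ expo J
  X_pow_mem : (X 0 : PS) ^ (k + n) ∈ J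

theorem X_zero_dvd_series {f : PS} : (X 0 : PS) ∣ f ↔ ∀ j, coeff (pt 0 j) f = 0 := by
  rw [X_dvd_iff]
  refine ⟨fun h j => h _ (pt_zero 0 j), fun h m hm => ?_⟩
  rw [← pt_eta m, hm]
  exact h _

/-- Modulo x the series y + h is y, a nonzerodivisor; so x divides the cofactor and can be
cancelled, which lowers N. -/
theorem X_one_add_not_dvd {h : PS} (hh : (X 0 : PS) ∣ h) (N : ℕ) :
    ¬ (X 1 + h) ∣ (X 0 : PS) ^ N := by
  induction N with
  | zero =>
    rintro ⟨g, hg⟩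
    have h0 : constantCoeff h = 0 := by
      obtain ⟨h', rfl⟩ := hh
      simp
    have := congrArg constantCoeff hg
    simp [h0] at this
  | succ N ih =>
    rintro ⟨g, hg⟩
    have hXg : (X 0 : PS) ∣ X 1 * g := by
      have h1 : (X 0 : PS) ∣ (X 1 + h) * g := hg ▸ dvd_pow_self _ N.succ_ne_zero
      rw [add_mul] at h1
      exact (dvd_add_left (hh.mul_right g)).1 h1
    have hX : (X 0 : PS) ∣ g := by
      rw [X_zero_dvd_series] at hXg ⊢
      intro j
      have h2 := hXg (j + 1)
      rwa [show pt 0 (j + 1) = Finsupp.single 1 1 + pt 0 j by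
        rw [pt_eq_iff]; simp [add_comm], X, coeff_add_monomial_mul, one_mul] at h2
    obtain ⟨g', rfl⟩ := hX
    have hX0 : (X 0 : PS) ≠ 0 := fun h0 => by
      have := congrArg (coeff (Finsupp.single 0 1)) h0
      simp at this
    refine ih ⟨g', mul_left_cancel₀ hX0 ?_⟩
    rw [← pow_succ', hg]
    ring

/-- A generator x^a (y + h)^b divides a power of x, hence b = 0. Conversely, ν = 0 provides an
element x^k times a unit, and J = (x^k). -/
theorem IsRegular.isDepthZero_iff {J : Ideal PS} {k ν n : ℕ} (h : IsRegular J k ν n) :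
    IsDepthZero J ↔ ν = 0 := by
  constructor
  · rintro ⟨a, b, t, ht, ht0, rfl⟩
    have hb : b = 0 := by
      by_contra hb
      have h1 := Ideal.mem_span_singleton.1 h.X_pow_mem
      refine X_one_add_not_dvd ?_ _ (((dvd_pow_self (X 1 + t) hb).mul_left _).trans h1)
      rw [X_zero_dvd_series]
      intro j
      by_cases hj : j = 0
      · subst hj
        rw [show pt 0 0 = 0 by rw [pt_eq_iff]; simp]
        exact ht0
      · exact ht _ (by simpa using hj)
    subst hb
    rw [pow_zero, mul_one] at h
    obtain ⟨f, hf, hfc⟩ := h.mem_expo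
    have hak : a ≤ k := by
      by_contra hlt
      push Not at hlt
      exact hfc (X_pow_dvd_iff.1 (Ideal.mem_span_singleton.1 hf) _ (by simpa using hlt))
    have h2 := h.coeff_eq_zero _ (Ideal.mem_span_singleton_self _) (pt a 0)
    rw [show pt a 0 = Finsupp.single 0 a by rw [pt_eq_iff]; simp, coeff_X_pow, if_pos rfl] at h2
    have h3 := mt h2 one_ne_zero
    simp at h3
    omega
  · rintro rfl
    refine ⟨k, 0, 0, by simp, by simp, ?_⟩
    rw [pow_zero, mul_one]
    apply le_antisymm
    · intro f hf
      rw [Ideal.mem_span_singleton, X_pow_dvd_iff]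
      exact fun m hm => h.coeff_eq_zero f hf m (Or.inl hm)
    · rw [Ideal.span_singleton_le_iff_mem]
      obtain ⟨f, hf, hfc⟩ := h.mem_expo
      obtain ⟨u, rfl⟩ : (X 0 : PS) ^ k ∣ f :=
        X_pow_dvd_iff.2 fun m hm => h.coeff_eq_zero f hf m (Or.inl hm)
      simp only at hfc
      rw [show pt k 0 = Finsupp.single 0 k + 0 by rw [pt_eq_iff]; simp, X_pow_eq,
        coeff_add_monomial_mul, one_mul] at hfc
      have hu : IsUnit u := isUnit_iff_constantCoeff.2 (IsUnit.mk0 _ hfc)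
      exact (Ideal.mul_unit_mem_iff_mem J hu).1 hf

theorem IsRegular.expo_min {J : Ideal PS} {k ν n : ℕ} (h : IsRegular J k ν n) :
    ∀ e ∈ expo J, k ≤ e.1 ∧ (e.1 = k → ν ≤ e.2) := by
  rintro e ⟨f, hf, hfe⟩
  refine ⟨?_, fun he => ?_⟩
  · by_contra hlt
    exact hfe (h.coeff_eq_zero f hf _ (Or.inl (by simpa using hlt)))
  · by_contra hlt
    exact hfe (h.coeff_eq_zero f hf _ (Or.inr (by simpa [he] using hlt)))

theorem IsRegular.axis_mem_expo {J : Ideal PS} {k ν n : ℕ} (h : IsRegular J k ν n) :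
    (k + n, 0) ∈ expo J := by
  refine ⟨_, h.X_pow_mem, ?_⟩
  rw [show pt (k + n) 0 = Finsupp.single 0 (k + n) by rw [pt_eq_iff]; simp, coeff_X_pow, if_pos rfl]
  exact one_ne_zero

/-- The power x^(k+n) goes to a unit times x^(p(k+n)), and N ≤ p(k+n) because (k+n, 0) is an
exponent of J. -/
theorem IsRegular.transform {J : Ideal PS} {k ν n : ℕ} (h : IsRegular J k ν n) {σ : NewtonMap}
    {N d : ℕ} {F : MvPolynomial (Fin 2) ℂ} (hL : IsFace J ⟨σ.p, σ.q, N⟩)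
    (hF : IsFaceData J ⟨σ.p, σ.q, N⟩ F d) :
    IsRegular (σ.transform J) N ((dehom F).rootMultiplicity σ.μ) (σ.p * (k + n) - N) := by
  obtain ⟨hp, hq, -, hN, -⟩ := isFace_iff.1 hL
  obtain ⟨a, b, W, hn⟩ := hF.exists_isNormalForm hp hq
  obtain ⟨h1, h2⟩ := hn.transform hN
  refine ⟨h1, h2, ?_⟩
  have h3 := hN _ h.axis_mem_expo
  simp only [mul_zero, add_zero] at h3
  rw [Nat.add_sub_cancel' h3]
  have h4 : σ.hom (X 0 ^ (k + n)) ∈ σ.transform J := Ideal.mem_map_of_mem _ h.X_pow_mem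
  rw [map_pow, σ.hom_X, NewtonMap.image, Matrix.cons_val_zero, mul_pow, ← pow_mul] at h4
  refine (Ideal.unit_mul_mem_iff_mem _ ?_).1 h4
  exact ((IsUnit.mk0 _ (pow_ne_zero _ σ.μ_ne_zero)).map (C : ℂ →+* PS)).pow _

/-- This is the termination of the tree. The multiplicity is at most M = deg F + d ≤ b + pM ≤ ν.
Equality forces p = 1, b = 0 and M = ν, so the line gives N = a + qν ≥ k + qν, and the new exponent
k + n - N is less than n. -/
theorem IsRegular.transform_lt {J : Ideal PS} {k ν n : ℕ} (h : IsRegular J k ν n) (hν : 0 < ν)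
    {σ : NewtonMap} {N d : ℕ} {F : MvPolynomial (Fin 2) ℂ} (hL : IsFace J ⟨σ.p, σ.q, N⟩)
    (hF : IsFaceData J ⟨σ.p, σ.q, N⟩ F d) :
    (dehom F).rootMultiplicity σ.μ < ν ∨
      (dehom F).rootMultiplicity σ.μ = ν ∧ σ.p * (k + n) - N < n := by
  obtain ⟨hp, hq, -, hN, -⟩ := isFace_iff.1 hL
  obtain ⟨a, b, W, hn⟩ := hF.exists_isNormalForm hp hq
  obtain ⟨hu, -, -⟩ := hn.extent hp
  have hm : (dehom F).rootMultiplicity σ.μ ≤ (dehom F).natDegree := by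
    rw [← Polynomial.count_roots]
    exact (Multiset.count_le_card _ _).trans (Polynomial.card_roots' _)
  have hw := hn.weight_eq
  simp only at hp hq hw hu hN
  set M := (dehom F).natDegree + d with hM
  have h1 : N ≤ σ.p * k + σ.q * ν := hN _ h.mem_expo
  have hak : k ≤ a := (h.expo_min _ hu).1
  have h2 := Nat.mul_le_mul_left σ.p hak
  have h3 : σ.q * (b + σ.p * M) ≤ σ.q * ν := by
    have : σ.q * (b + σ.p * M) = σ.q * b + σ.p * σ.q * M := by ring
    omega
  have h4 : b + σ.p * M ≤ ν := Nat.le_of_mul_le_mul_left h3 hq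
  have h5 : M ≤ σ.p * M := Nat.le_mul_of_pos_left M hp
  rcases lt_or_ge ((dehom F).rootMultiplicity σ.μ) ν with hlt | hge
  · exact Or.inl hlt
  · have hMν : M = ν := by omega
    have hp1 : σ.p = 1 := by
      have : σ.p * ν = 1 * ν := by rw [← hMν]; omega
      exact Nat.eq_of_mul_eq_mul_right hν this
    refine Or.inr ⟨by omega, ?_⟩
    have h6 := hN _ h.axis_mem_expo
    simp only [mul_zero, add_zero] at h6
    rw [hp1, hMν, one_mul, one_mul] at hw
    rw [hp1, one_mul] at h6 ⊢
    have := Nat.mul_pos hq hν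
    omega

/-! ### Decomposition of the set of dicritical vertices -/

/-- The vertex of the tree of `I` given by a vertex of the tree of `I_σ`. -/
def Vertex.cons (σ : NewtonMap) (v : Vertex) : Vertex := ⟨σ :: v.path, v.face, v.d⟩

theorem Vertex.cons_injective (σ : NewtonMap) : Function.Injective (Vertex.cons σ) := by
  rintro ⟨l, L, d⟩ ⟨l', L', d'⟩ h
  simpa [Vertex.cons] using h

/-- The product of the decorations `p` along the path to a vertex. -/
def Vertex.prodP (v : Vertex) : ℕ := (v.path.map NewtonMap.p).prod * v.face.p

/-- The weight of a vertex, with a contribution `g p q` of the first face on the path. -/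
def Vertex.weight (g : ℕ → ℕ → ℕ) (v : Vertex) : ℕ :=
  match v.path with
  | [] => g v.face.p v.face.q
  | σ :: l => g σ.p σ.q * ((l.map NewtonMap.p).prod * v.face.p)

theorem Vertex.weight_cons (g : ℕ → ℕ → ℕ) (σ : NewtonMap) (v : Vertex) :
    (Vertex.cons σ v).weight g = g σ.p σ.q * v.prodP := rfl

theorem Vertex.weight_fst (v : Vertex) : v.weight (fun p _ => p) = v.prodP := by
  obtain ⟨l, L, d⟩ := v
  cases l <;> simp [Vertex.weight, Vertex.prodP, mul_assoc]

theorem Vertex.weight_min (v : Vertex) : v.weight min = v.rho := by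
  obtain ⟨l, L, d⟩ := v
  cases l with
  | nil => rfl
  | cons σ l =>
    simp only [Vertex.weight, Vertex.rho]
    rw [mul_assoc, mul_assoc, Nat.mul_min_mul_right]

theorem roots_ne_zero {I : Ideal PS} {L : Line} {F : MvPolynomial (Fin 2) ℂ} {d : ℕ}
    (hL : IsFace I L) (h : IsFaceData I L F d) {μ : ℂ} (hμ : μ ∈ (dehom F).roots) : μ ≠ 0 := by
  rintro rfl
  obtain ⟨a, b, W, hn⟩ := h.exists_isNormalForm hL.1 hL.2.1
  apply hn.coeff_zero
  rw [Polynomial.coeff_zero_eq_eval_zero]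
  exact (Polynomial.mem_roots'.1 hμ).2

/-- A face contributes g·d by itself and g·mult(μ) through the tree at each root μ, in total g·(deg
F + d). Leaving g free serves both the height (g = p) and ρ (g = min). -/
theorem exists_dicriticalVertices {J : Ideal PS} {k ν n : ℕ} (h : IsRegular J k ν n)
    (hν : 0 < ν)
    (IH : ∀ (σ : NewtonMap) (N d : ℕ) (F : MvPolynomial (Fin 2) ℂ), IsFace J ⟨σ.p, σ.q, N⟩ →
      IsFaceData J ⟨σ.p, σ.q, N⟩ F d → ∃ D : Finset Vertex,
        (∀ v, v ∈ D ↔ v ∈ dicriticalVertices (σ.transform J)) ∧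
        ∑ v ∈ D, v.prodP * v.d = (dehom F).rootMultiplicity σ.μ)
    (A : Finset Line) (hA : ∀ L, L ∈ A ↔ IsLatticeFace (expo J) L) :
    ∃ (M : Line → ℕ) (D : Finset Vertex),
      (∀ L ∈ A, ∃ a b, (a, b + L.p * M L) ∈ expo J ∧ (a + L.q * M L, b) ∈ expo J ∧
        L.N = L.p * a + L.q * b + L.p * L.q * M L ∧
        ∀ e ∈ expo J, L.p * e.1 + L.q * e.2 = L.N →
          ∃ j ≤ M L, e = (a + L.q * (M L - j), b + L.p * j)) ∧
      (∀ v, v ∈ D ↔ v ∈ dicriticalVertices J) ∧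
      ∀ g : ℕ → ℕ → ℕ, ∑ v ∈ D, v.weight g * v.d = ∑ L ∈ A, g L.p L.q * M L := by
  classical
  have hAF : ∀ L, L ∈ A ↔ IsFace J L := fun L => (hA L).trans isFace_iff.symm
  have hdz : ¬ IsDepthZero J := fun hz => hν.ne' (h.isDepthZero_iff.1 hz)
  have hdata : ∀ L, ∃ F d, L ∈ A → IsFaceData J L F d := by
    intro L
    by_cases hL : L ∈ A
    · obtain ⟨F, d, hF⟩ := exists_isFaceData ((hAF L).1 hL)
      exact ⟨F, d, fun _ => hF⟩
    · exact ⟨0, 0, fun h => absurd h hL⟩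
  choose F d hF using hdata
  have hmap : ∀ L μ, ∃ σ : NewtonMap, L ∈ A → μ ≠ 0 → σ.p = L.p ∧ σ.q = L.q ∧ σ.μ = μ := by
    intro L μ
    by_cases hL : L ∈ A ∧ μ ≠ 0
    · obtain ⟨hp, hq, hc, -⟩ := (hAF L).1 hL.1
      obtain ⟨σ, hσ⟩ := exists_newtonMap hp hq hc hL.2
      exact ⟨σ, fun _ _ => hσ⟩
    · obtain ⟨σ, -⟩ := exists_newtonMap one_pos one_pos (Nat.coprime_one_left 1) one_ne_zero
      exact ⟨σ, fun h1 h2 => absurd ⟨h1, h2⟩ hL⟩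
  choose s hs using hmap
  have hline : ∀ L ∈ A, ∀ μ ≠ 0, (⟨(s L μ).p, (s L μ).q, L.N⟩ : Line) = L := by
    intro L hL μ hμ
    obtain ⟨h1, h2, -⟩ := hs L μ hL hμ
    exact Line.ext h1 h2 rfl
  have hroot : ∀ L ∈ A, ∀ μ ∈ (dehom (F L)).roots, μ ≠ 0 := fun L hL μ hμ =>
    roots_ne_zero ((hAF L).1 hL) (hF L hL) hμ
  have hsub : ∀ L μ, ∃ D : Finset Vertex, L ∈ A → μ ∈ (dehom (F L)).roots →
      (∀ v, v ∈ D ↔ v ∈ dicriticalVertices ((s L μ).transform J)) ∧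
        ∑ v ∈ D, v.prodP * v.d = (dehom (F L)).rootMultiplicity μ := by
    intro L μ
    by_cases hL : L ∈ A ∧ μ ∈ (dehom (F L)).roots
    · have hμ := hroot L hL.1 μ hL.2
      have h1 := hline L hL.1 μ hμ
      obtain ⟨D, hD⟩ := IH (s L μ) L.N (d L) (F L) (by rw [h1]; exact (hAF L).1 hL.1)
        (by rw [h1]; exact hF L hL.1)
      rw [(hs L μ hL.1 hμ).2.2] at hD
      exact ⟨D, fun _ _ => hD⟩
    · exact ⟨∅, fun h1 h2 => absurd ⟨h1, h2⟩ hL⟩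
  choose T hT using hsub
  set D₀ : Finset Vertex := (A.filter (0 < d ·)).image fun L => ⟨[], L, d L⟩ with hD₀
  set P : Finset (Σ _ : Line, ℂ) := A.sigma fun L => (dehom (F L)).roots.toFinset with hP
  have hPmem : ∀ x ∈ P, x.1 ∈ A ∧ x.2 ∈ (dehom (F x.1)).roots := fun x hx => by
    simpa [hP] using hx
  have hsp : ∀ x ∈ P, (s x.1 x.2).p = x.1.p ∧ (s x.1 x.2).q = x.1.q ∧ (s x.1 x.2).μ = x.2 :=
    fun x hx => hs _ _ (hPmem x hx).1 (hroot _ (hPmem x hx).1 _ (hPmem x hx).2)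
  set D₁ : Finset Vertex :=
    P.biUnion fun x => (T x.1 x.2).image (Vertex.cons (s x.1 x.2)) with hD₁
  have hdisj : Disjoint D₀ D₁ := by
    rw [Finset.disjoint_left]
    intro v hv hv'
    simp only [hD₀, hD₁, Finset.mem_image, Finset.mem_biUnion] at hv hv'
    obtain ⟨L, -, rfl⟩ := hv
    obtain ⟨x, -, v, -, hv⟩ := hv'
    simp [Vertex.cons] at hv
  have hface_ext : ∀ L ∈ A, ∀ L' ∈ A, L.p = L'.p → L.q = L'.q → L = L' := by
    intro L hL L' hL' hp hq
    exact ((hA L).1 hL).eq_of_slope_eq ((hA L').1 hL') (by rw [hp, hq])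
  -- A Newton map determines its face and root, so trees attached at different places share no
  -- vertex.
  have hpair : ∀ x ∈ P, ∀ y ∈ P, s x.1 x.2 = s y.1 y.2 → x = y := by
    rintro ⟨L, μ⟩ hx ⟨L', μ'⟩ hy hxy
    obtain ⟨h1, h2, h3⟩ := hsp _ hx
    obtain ⟨h1', h2', h3'⟩ := hsp _ hy
    simp only at h1 h2 h3 h1' h2' h3' hxy
    rw [hxy] at h1 h2 h3
    obtain rfl := hface_ext L (hPmem _ hx).1 L' (hPmem _ hy).1 (by rw [← h1, h1'])
      (by rw [← h2, h2'])
    rw [← h3, h3']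
  refine ⟨fun L => (dehom (F L)).natDegree + d L, D₀ ∪ D₁, fun L hL => ?_, fun v => ?_,
    fun g => ?_⟩
  · have hLf := (hAF L).1 hL
    obtain ⟨a, b, W, hn⟩ := (hF L hL).exists_isNormalForm hLf.1 hLf.2.1
    obtain ⟨h1, h2, h3⟩ := hn.extent hLf.1
    exact ⟨a, b, h1, h2, hn.weight_eq, h3⟩
  · obtain ⟨l, L, e⟩ := v
    rw [Finset.mem_union]
    cases l with
    | nil =>
      have h1 : (⟨[], L, e⟩ : Vertex) ∉ D₁ := by
        simp [hD₁, Vertex.cons]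
      have h2 : (⟨[], L, e⟩ : Vertex) ∈ D₀ ↔ L ∈ A ∧ 0 < d L ∧ d L = e := by
        simp only [hD₀, Finset.mem_image, Finset.mem_filter, Vertex.mk.injEq, true_and]
        constructor
        · rintro ⟨L', ⟨hL', hd⟩, rfl, rfl⟩
          exact ⟨hL', hd, rfl⟩
        · rintro ⟨hL, hd, rfl⟩
          exact ⟨L, ⟨hL, hd⟩, rfl, rfl⟩
      rw [or_iff_left h1, h2]
      constructor
      · rintro ⟨hL, hd, rfl⟩
        exact ⟨⟨hdz, (hAF L).1 hL, F L, hF L hL⟩, hd⟩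
      · rintro ⟨⟨-, hL, F', hF'⟩, hd⟩
        have hLA := (hAF L).2 hL
        have h3 := ((hF L hLA).unique hL hF').2
        simp only at hd h3
        exact ⟨hLA, h3 ▸ hd, h3⟩
    | cons σ l =>
      have h1 : (⟨σ :: l, L, e⟩ : Vertex) ∉ D₀ := by
        simp [hD₀]
      have h2 : (⟨σ :: l, L, e⟩ : Vertex) ∈ D₁ ↔
          ∃ x ∈ P, s x.1 x.2 = σ ∧ (⟨l, L, e⟩ : Vertex) ∈ T x.1 x.2 := by
        simp only [hD₁, Finset.mem_biUnion, Finset.mem_image]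
        refine exists_congr fun x => and_congr_right fun _ => ?_
        constructor
        · rintro ⟨⟨l', L', e'⟩, hv, heq⟩
          simp only [Vertex.cons, Vertex.mk.injEq, List.cons.injEq] at heq
          obtain ⟨⟨h3, rfl⟩, rfl, rfl⟩ := heq
          exact ⟨h3, hv⟩
        · rintro ⟨rfl, hv⟩
          exact ⟨_, hv, rfl⟩
      rw [or_iff_right h1, h2]
      constructor
      · rintro ⟨x, hx, rfl, hv⟩
        obtain ⟨hxA, hxr⟩ := hPmem x hx
        obtain ⟨hv1, hv2⟩ := ((hT _ _ hxA hxr).1 _).1 hv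
        have h4 := hline _ hxA _ (hroot _ hxA _ hxr)
        refine ⟨⟨hdz, ⟨x.1.N, F x.1, d x.1, ?_, ?_, ?_⟩, hv1⟩, hv2⟩
        · rw [h4]; exact (hAF _).1 hxA
        · rw [h4]; exact hF _ hxA
        · rw [(hsp x hx).2.2, ← eval_dehom]
          exact (Polynomial.mem_roots'.1 hxr).2
      · rintro ⟨⟨-, ⟨N, F', d', hL', hF', hev⟩, hv⟩, he⟩
        have hLA := (hAF _).2 hL'
        -- The step may use other face data than the chosen ones; uniqueness of the roots reconciles
        -- them.
        have hr : σ.μ ∈ (dehom (F ⟨σ.p, σ.q, N⟩)).roots := by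
          rw [((hF _ hLA).unique hL' hF').1]
          obtain ⟨a, b, W, hn⟩ := hF'.exists_isNormalForm hL'.1 hL'.2.1
          rw [Polynomial.mem_roots hn.monic.ne_zero, Polynomial.IsRoot, eval_dehom]
          exact hev
        have hx : (⟨⟨σ.p, σ.q, N⟩, σ.μ⟩ : Σ _ : Line, ℂ) ∈ P := by
          simp only [hP, Finset.mem_sigma, Multiset.mem_toFinset]
          exact ⟨hLA, hr⟩
        obtain ⟨h3, h4, h5⟩ := hsp _ hx
        have hσ := NewtonMap.ext_of h3 h4 h5
        refine ⟨_, hx, hσ, ((hT _ _ hLA hr).1 _).2 ?_⟩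
        simp only at hσ
        rw [hσ]
        exact ⟨hv, he⟩
  · rw [Finset.sum_union hdisj]
    have e1 : ∑ v ∈ D₀, v.weight g * v.d = ∑ L ∈ A, g L.p L.q * d L := by
      rw [hD₀, Finset.sum_image (by intro x _ y _ hxy; simpa using And.left (by simpa using hxy)),
        Finset.sum_filter]
      refine Finset.sum_congr rfl fun L _ => ?_
      split_ifs with hd
      · rfl
      · rw [Nat.eq_zero_of_not_pos hd, mul_zero]
    have e2 : ∑ v ∈ D₁, v.weight g * v.d = ∑ L ∈ A, g L.p L.q * (dehom (F L)).natDegree := by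
      rw [hD₁, Finset.sum_biUnion]
      · rw [hP, Finset.sum_sigma]
        refine Finset.sum_congr rfl fun L hL => ?_
        have e3 : ∀ μ ∈ (dehom (F L)).roots.toFinset,
            ∑ v ∈ (T L μ).image (Vertex.cons (s L μ)), v.weight g * v.d =
              g L.p L.q * (dehom (F L)).roots.count μ := by
          intro μ hμ
          rw [Multiset.mem_toFinset] at hμ
          obtain ⟨h1, h2, -⟩ := hs L μ hL (hroot L hL μ hμ)
          rw [Finset.sum_image (fun _ _ _ _ hxy => Vertex.cons_injective _ hxy),
            Polynomial.count_roots, ← (hT L μ hL hμ).2, Finset.mul_sum]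
          refine Finset.sum_congr rfl fun v _ => ?_
          rw [Vertex.weight_cons, h1, h2, mul_assoc]
          rfl
        rw [Finset.sum_congr rfl e3, ← Finset.mul_sum, Multiset.toFinset_sum_count_eq,
          IsAlgClosed.card_roots_eq_natDegree]
      · intro x hx y hy hxy
        rw [Function.onFun, Finset.disjoint_left]
        intro v hv hv'
        simp only [Finset.mem_image] at hv hv'
        obtain ⟨w, -, rfl⟩ := hv
        obtain ⟨w', -, hw'⟩ := hv'
        apply hxy
        refine hpair x hx y hy ?_
        simp only [Vertex.cons, Vertex.mk.injEq, List.cons.injEq] at hw'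
        exact hw'.1.1.symm
    rw [e1, e2, ← Finset.sum_add_distrib]
    exact Finset.sum_congr rfl fun L _ => by ring

/-! ### The height of an ideal -/

theorem not_mem_dicriticalVertices {J : Ideal PS} (h : IsDepthZero J) (v : Vertex) :
    v ∉ dicriticalVertices J := by
  rintro ⟨hv, -⟩
  obtain ⟨l, L, d⟩ := v
  cases l <;> exact hv.1 h

theorem extent_bounds {E : Set (ℕ × ℕ)} {L : Line} {a b M : ℕ} (hu : (a, b + L.p * M) ∈ E)
    (hl : (a + L.q * M, b) ∈ E) (hN : L.N = L.p * a + L.q * b + L.p * L.q * M)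
    (hon : ∀ e ∈ E, L.p * e.1 + L.q * e.2 = L.N →
      ∃ j ≤ M, e = (a + L.q * (M - j), b + L.p * j)) :
    ∃ l ∈ E, ∃ u ∈ E, L.p * l.1 + L.q * l.2 = L.N ∧ L.p * u.1 + L.q * u.2 = L.N ∧
      (∀ e ∈ E, L.p * e.1 + L.q * e.2 = L.N → l.2 ≤ e.2 ∧ e.2 ≤ u.2) ∧ u.2 = l.2 + L.p * M := by
  refine ⟨_, hl, _, hu, by rw [hN]; ring, by rw [hN]; ring, fun e he heN => ?_, rfl⟩
  obtain ⟨j, hj, rfl⟩ := hon e he heN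
  exact ⟨Nat.le_add_right _ _, Nat.add_le_add_left (Nat.mul_le_mul_left _ hj) _⟩

theorem IsRegular.exists_latticeFaces {J : Ideal PS} {k ν n : ℕ} (h : IsRegular J k ν n) :
    ∃ A : Finset Line, (∀ L, L ∈ A ↔ IsLatticeFace (expo J) L) ∧
      ∀ f : Line → ℕ, (∀ L ∈ A, ∃ l ∈ expo J, ∃ u ∈ expo J, L.p * l.1 + L.q * l.2 = L.N ∧
        L.p * u.1 + L.q * u.2 = L.N ∧
        (∀ e ∈ expo J, L.p * e.1 + L.q * e.2 = L.N → l.2 ≤ e.2 ∧ e.2 ≤ u.2) ∧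
        u.2 = l.2 + f L) → ∑ L ∈ A, f L = ν := by
  simpa using NewtonTree.exists_latticeFaces h.mem_expo h.expo_min ⟨_, h.axis_mem_expo, rfl⟩
    (fun _ _ => Nat.zero_le _)

/-- The dicritical vertices of the tree of `J`, counted with their degrees and the products of the
decorations `p`, add up to the height of `J`. -/
theorem IsRegular.sum_prodP {J : Ideal PS} {k ν n : ℕ} (h : IsRegular J k ν n) :
    ∃ D : Finset Vertex, (∀ v, v ∈ D ↔ v ∈ dicriticalVertices J) ∧
      ∑ v ∈ D, v.prodP * v.d = ν := by
  -- Lexicographic induction on (ν, n), with k arbitrary since it changes to N under a transform.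
  induction ν using Nat.strong_induction_on generalizing J k n with
  | _ ν ihν =>
  induction n using Nat.strong_induction_on generalizing J k with
  | _ n ihn =>
  rcases Nat.eq_zero_or_pos ν with rfl | hν
  · refine ⟨∅, fun v => ?_, by simp⟩
    simpa using not_mem_dicriticalVertices (h.isDepthZero_iff.2 rfl) v
  obtain ⟨A, hA, hsum⟩ := h.exists_latticeFaces
  obtain ⟨M, D, hM, hD, hg⟩ := exists_dicriticalVertices h hν (by
    intro σ N d F hL hF
    have hreg := h.transform hL hF
    rcases h.transform_lt hν hL hF with hlt | ⟨heq, hlt⟩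
    · exact ihν _ hlt hreg
    · rw [heq] at hreg ⊢
      exact ihn _ hlt hreg) A hA
  refine ⟨D, hD, ?_⟩
  have h1 := hg fun p _ => p
  simp only [Vertex.weight_fst] at h1
  rw [h1]
  refine hsum _ fun L hL => ?_
  obtain ⟨a, b, hu, hl, hN, hon⟩ := hM L hL
  exact extent_bounds hu hl hN hon

/-! ### The order of the Newton polygon -/

/-- The image of a set of lattice points under `(α, β) ↦ (α, α + β)`. -/
def shear (E : Set (ℕ × ℕ)) : Set (ℕ × ℕ) := (fun e => (e.1, e.1 + e.2)) '' E

/-- The line that corresponds to a line `L` under the shear. -/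
def Line.unshear (L : Line) : Line := ⟨L.p + L.q, L.q, L.N⟩

theorem weight_unshear (L : Line) (e : ℕ × ℕ) :
    L.unshear.p * e.1 + L.unshear.q * e.2 = L.p * e.1 + L.q * (e.1 + e.2) := by
  simp only [Line.unshear]; ring

/-- A weight pα + qβ on the sheared set pulls back to (p + q)α + qβ. The edges of the sheared set
are thus exactly the edges of E with q < p, with p replaced by p - q. -/
theorem isLatticeFace_shear {E : Set (ℕ × ℕ)} {L : Line} :
    IsLatticeFace (shear E) L ↔ 0 < L.p ∧ IsLatticeFace E L.unshear := by
  have key : ∀ l u : ℕ × ℕ, 0 < L.p → 0 < L.q → L.p * l.1 + L.q * (l.1 + l.2) = L.N →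
      L.p * u.1 + L.q * (u.1 + u.2) = L.N → (l.1 + l.2 < u.1 + u.2 ↔ l.2 < u.2) := by
    intro l u hp hq hl hu
    constructor
    · intro hlt
      have h1 := Nat.mul_lt_mul_of_pos_left hlt hq
      have h2 : u.1 < l.1 := Nat.lt_of_mul_lt_mul_left (a := L.p) (by omega)
      omega
    · intro hlt
      by_contra hge
      push Not at hge
      have h1 := Nat.mul_le_mul_left L.q hge
      have h2 : l.1 ≤ u.1 := Nat.le_of_mul_le_mul_left (c := L.p) (by omega) hp
      omega
  unfold IsLatticeFace
  constructor
  · rintro ⟨hp, hq, hc, hle, _, ⟨l, hl, rfl⟩, _, ⟨u, hu, rfl⟩, hlN, huN, hlu⟩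
    refine ⟨hp, Nat.add_pos_left hp _, hq, by simpa [Line.unshear] using hc, fun e he => ?_,
      l, hl, u, hu, ?_, ?_, (key l u hp hq hlN huN).1 hlu⟩
    · rw [weight_unshear]; exact hle _ ⟨e, he, rfl⟩
    · rw [weight_unshear]; exact hlN
    · rw [weight_unshear]; exact huN
  · rintro ⟨hp, -, hq, hc, hle, l, hl, u, hu, hlN, huN, hlu⟩
    rw [weight_unshear] at hlN huN
    refine ⟨hp, hq, by simpa [Line.unshear] using hc, ?_, _, ⟨l, hl, rfl⟩, _, ⟨u, hu, rfl⟩, hlN,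
      huN, (key l u hp hq hlN huN).2 hlu⟩
    rintro _ ⟨e, he, rfl⟩
    have := hle e he
    rwa [weight_unshear] at this

/-- The sheared polygon descends from (0, ν) to height m, so Σ (p - q) M over the edges with q < p
equals ν - m. Subtracting this from Σ p M = ν leaves Σ min(p, q) M. -/
theorem IsRegular.sum_min_eq {I : Ideal PS} {ν n m : ℕ} (h : IsRegular I 0 ν n)
    (hm : ∃ e ∈ expo I, e.1 + e.2 = m) (hm_le : ∀ e ∈ expo I, m ≤ e.1 + e.2)
    {A : Finset Line} (hA : ∀ L, L ∈ A ↔ IsLatticeFace (expo I) L) {M : Line → ℕ}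
    (hM : ∀ L ∈ A, ∃ a b, (a, b + L.p * M L) ∈ expo I ∧ (a + L.q * M L, b) ∈ expo I ∧
        L.N = L.p * a + L.q * b + L.p * L.q * M L ∧
        ∀ e ∈ expo I, L.p * e.1 + L.q * e.2 = L.N →
          ∃ j ≤ M L, e = (a + L.q * (M L - j), b + L.p * j)) :
    ∑ L ∈ A, min L.p L.q * M L = m := by
  have hν : ∑ L ∈ A, L.p * M L = ν := by
    obtain ⟨B, hB, hsum⟩ := h.exists_latticeFaces
    obtain rfl : A = B := by ext L; rw [hA, hB]
    refine hsum _ fun L hL => ?_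
    obtain ⟨a, b, hu, hl, hN, hon⟩ := hM L hL
    exact extent_bounds hu hl hN hon
  obtain ⟨A', hA', hsum'⟩ := NewtonTree.exists_latticeFaces (E := shear (expo I)) (k := 0) (ν := ν)
    (m := m) ⟨_, h.mem_expo, by simp⟩ (by
      rintro _ ⟨e, he, rfl⟩
      refine ⟨Nat.zero_le _, fun h0 => ?_⟩
      have := (h.expo_min e he).2 h0
      simp only
      omega) (by
      obtain ⟨e, he, hem⟩ := hm
      exact ⟨_, ⟨e, he, rfl⟩, hem⟩) (by
      rintro _ ⟨e, he, rfl⟩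
      exact hm_le e he)
  have hmem : ∀ L, L ∈ A' ↔ 0 < L.p ∧ L.unshear ∈ A := fun L => by
    rw [hA', hA, isLatticeFace_shear]
  -- The shear is unimodular, so an edge keeps its number M of lattice steps.
  have hs := hsum' (fun L => L.p * M L.unshear) (by
    intro L hL
    obtain ⟨a, b, hu, hl, hN, hon⟩ := hM _ ((hmem L).1 hL).2
    simp only [Line.unshear] at hu hl hN hon
    set D := M L.unshear with hD
    have hD' : M ⟨L.p + L.q, L.q, L.N⟩ = D := rfl
    rw [hD'] at hu hl hN hon
    refine ⟨_, ⟨_, hl, rfl⟩, _, ⟨_, hu, rfl⟩, by rw [hN]; ring, by rw [hN]; ring, ?_, by ring⟩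
    rintro _ ⟨e, he, rfl⟩ heN
    obtain ⟨j, hj, rfl⟩ := hon e he (by rw [← heN]; ring)
    obtain ⟨i, hi⟩ := Nat.exists_eq_add_of_le hj
    simp only [hi, Nat.add_sub_cancel_left]
    constructor <;> nlinarith [Nat.zero_le (L.p * j), Nat.zero_le (L.p * i)])
  have hbij : ∑ L ∈ A', L.p * M L.unshear = ∑ L ∈ A.filter (fun L => L.q < L.p),
      (L.p - L.q) * M L := by
    refine Finset.sum_nbij' Line.unshear (fun L => ⟨L.p - L.q, L.q, L.N⟩) ?_ ?_ ?_ ?_ ?_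
    · intro L hL
      have := (hmem L).1 hL
      rw [Finset.mem_filter]
      exact ⟨this.2, Nat.lt_add_of_pos_left this.1⟩
    · intro L hL
      rw [Finset.mem_filter] at hL
      rw [hmem]
      refine ⟨Nat.sub_pos_of_lt hL.2, ?_⟩
      simp only [Line.unshear, Nat.sub_add_cancel hL.2.le]
      exact hL.1
    · intro L _
      simp [Line.unshear]
    · intro L hL
      rw [Finset.mem_filter] at hL
      simp only [Line.unshear, Nat.sub_add_cancel hL.2.le]
    · intro L _
      simp [Line.unshear]
  have hsplit : ∑ L ∈ A, min L.p L.q * M L +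
      ∑ L ∈ A.filter (fun L => L.q < L.p), (L.p - L.q) * M L = ∑ L ∈ A, L.p * M L := by
    rw [Finset.sum_filter, ← Finset.sum_add_distrib]
    refine Finset.sum_congr rfl fun L _ => ?_
    split_ifs with hlt
    · rw [min_eq_right hlt.le, ← add_mul, Nat.add_sub_cancel' hlt.le]
    · rw [min_eq_left (not_lt.1 hlt), add_zero]
  omega

/-! ### Powers of the maximal ideal -/

theorem mem_maximalIdeal_iff {f : PS} :
    f ∈ IsLocalRing.maximalIdeal PS ↔ constantCoeff f = 0 := by
  rw [IsLocalRing.mem_maximalIdeal, mem_nonunits_iff, isUnit_iff_constantCoeff, isUnit_iff_ne_zero,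
    not_not]

theorem maximalIdeal_pow_le (k : ℕ) :
    IsLocalRing.maximalIdeal PS ^ k ≤ vanishingIdeal (isLowerSet_weight_lt 1 1 k) := by
  classical
  induction k with
  | zero => exact fun f _ n hn => absurd hn (Nat.not_lt_zero _)
  | succ k ih =>
    rw [pow_succ, Ideal.mul_le]
    intro f hf g hg n (hn : 1 * n 0 + 1 * n 1 < k + 1)
    rw [coeff_mul]
    refine Finset.sum_eq_zero fun x hx => ?_
    have hadd := Finset.HasAntidiagonal.mem_antidiagonal.1 hx
    have h0 : x.1 0 + x.2 0 = n 0 := by rw [← hadd]; rfl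
    have h1 : x.1 1 + x.2 1 = n 1 := by rw [← hadd]; rfl
    by_cases hlt : 1 * x.1 0 + 1 * x.1 1 < k
    · rw [ih hf x.1 hlt, zero_mul]
    · have hx2 : x.2 = 0 := by
        ext i
        fin_cases i
        · show x.2 0 = 0
          omega
        · show x.2 1 = 0
          omega
      rw [hx2, coeff_zero_eq_constantCoeff_apply, mem_maximalIdeal_iff.1 hg, mul_zero]

theorem exists_eq_X_mul_add (f : PS) (hf : constantCoeff f = 0) :
    ∃ g h : PS, f = X 0 * g + X 1 * h ∧ (∀ n, coeff n g = coeff (Finsupp.single 0 1 + n) f) ∧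
      ∀ n, coeff n h = 0 ∨ coeff n h = coeff (Finsupp.single 1 1 + n) f := by
  let g : PS := fun n => coeff (Finsupp.single 0 1 + n) f
  -- All terms divisible by x go to g; h only receives the pure powers of y.
  let h : PS := fun n => if n 0 = 0 then coeff (Finsupp.single 1 1 + n) f else 0
  have hg : ∀ n, coeff n g = coeff (Finsupp.single 0 1 + n) f := fun _ => rfl
  have hh : ∀ n, coeff n h = if n 0 = 0 then coeff (Finsupp.single 1 1 + n) f else 0 := fun _ => rfl
  refine ⟨g, h, ?_, hg, fun n => by rw [hh]; split_ifs <;> simp⟩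
  ext n
  obtain ⟨i, j, rfl⟩ : ∃ i j, n = pt i j := ⟨n 0, n 1, (pt_eta n).symm⟩
  have hX : ∀ (s : Fin 2) (u : PS) (m : Fin 2 →₀ ℕ), m s = 0 → coeff m (X s * u) = 0 :=
    fun s u m hm => X_dvd_iff.1 (Dvd.intro _ rfl) m hm
  have hXs : ∀ (s : Fin 2) (u : PS) (m : Fin 2 →₀ ℕ),
      coeff (Finsupp.single s 1 + m) (X s * u) = coeff m u := fun s u m => by
    rw [X, coeff_add_monomial_mul, one_mul]
  have h1 : ∀ i j, pt i (j + 1) = Finsupp.single 1 1 + pt i j := fun i j => by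
    rw [pt_eq_iff]; simp [add_comm]
  rw [map_add]
  rcases i with - | i
  · rw [hX 0 g _ (by simp), zero_add]
    rcases j with - | j
    · rw [hX 1 h _ (by simp), show pt 0 0 = 0 by rw [pt_eq_iff]; simp]
      exact hf
    · rw [h1, hXs, hh, if_pos (by simp)]
  · have h2 : coeff (pt (i + 1) j) (X 1 * h) = 0 := by
      rcases j with - | j
      · exact hX 1 h _ (by simp)
      · rw [h1, hXs, hh, if_neg (by simp)]
    rw [h2, add_zero, show pt (i + 1) j = Finsupp.single 0 1 + pt i j by
      rw [pt_eq_iff]; simp [add_comm], hXs, hg]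

theorem mem_maximalIdeal_pow_of_coeff {k : ℕ} {f : PS}
    (hf : ∀ n : Fin 2 →₀ ℕ, n 0 + n 1 < k → coeff n f = 0) :
    f ∈ IsLocalRing.maximalIdeal PS ^ k := by
  induction k generalizing f with
  | zero => simp
  | succ k ih =>
    obtain ⟨g, h, rfl, hg, hh⟩ := exists_eq_X_mul_add f (hf 0 (by simp))
    rw [pow_succ']
    refine add_mem (Ideal.mul_mem_mul (mem_maximalIdeal_iff.2 (by simp)) (ih fun n hn => ?_))
      (Ideal.mul_mem_mul (mem_maximalIdeal_iff.2 (by simp)) (ih fun n hn => ?_))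
    · rw [hg]
      exact hf _ (by simp; omega)
    · rcases hh n with h0 | h0
      · exact h0
      · rw [h0]
        exact hf _ (by simp; omega)

theorem le_maximalIdeal_pow_iff {I : Ideal PS} {k : ℕ} :
    I ≤ IsLocalRing.maximalIdeal PS ^ k ↔ ∀ e ∈ expo I, k ≤ e.1 + e.2 := by
  constructor
  · rintro hI e ⟨f, hf, hfe⟩
    by_contra hlt
    exact hfe (maximalIdeal_pow_le k (hI hf) _ (show 1 * _ + 1 * _ < k by simpa using hlt))
  · intro h f hf
    refine mem_maximalIdeal_pow_of_coeff fun n hn => ?_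
    by_contra hne
    have := h (n 0, n 1) ⟨f, hf, by simpa using hne⟩
    simp only at this
    omega

/-! ### Ideals of finite codimension -/

/-- A variable is algebraic modulo I. Splitting an annihilating polynomial as t^r Q with Q(0) ≠ 0,
the value of Q at the variable is a unit of the local ring. -/
theorem exists_X_pow_mem {I : Ideal PS} (hI : FiniteDimensional ℂ (PS ⧸ I)) (i : Fin 2) :
    ∃ n, (X i : PS) ^ n ∈ I := by
  obtain ⟨P, hP, hPx⟩ := Algebra.IsIntegral.isIntegral (R := ℂ) (Ideal.Quotient.mk I (X i : PS))
  obtain ⟨Q, hQ, hQ0⟩ :=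
    Polynomial.exists_eq_pow_rootMultiplicity_mul_and_not_dvd P hP.ne_zero 0
  refine ⟨P.rootMultiplicity 0, ?_⟩
  have h1 : Polynomial.aeval (X i : PS) P ∈ I := by
    rw [← Ideal.Quotient.eq_zero_iff_mem, ← hPx]
    exact (Polynomial.aeval_algHom_apply (Ideal.Quotient.mkₐ ℂ I) (X i : PS) P).symm
  have h2 : IsUnit (Polynomial.aeval (X i : PS) Q) := by
    rw [isUnit_iff_constantCoeff, isUnit_iff_ne_zero]
    have h3 : constantCoeff (Polynomial.aeval (X i : PS) Q) = Q.eval 0 := by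
      rw [Polynomial.aeval_def, Polynomial.hom_eval₂, constantCoeff_X]
      rw [show (constantCoeff (σ := Fin 2) (R := ℂ)).comp (algebraMap ℂ PS) = RingHom.id ℂ from
        RingHom.ext fun z => show constantCoeff (C z : PS) = z from constantCoeff_C z]
      rfl
    rw [h3]
    exact fun h0 => hQ0 (Polynomial.dvd_iff_isRoot.2 h0)
  rw [hQ, map_mul, map_pow, map_sub, Polynomial.aeval_X, Polynomial.C_0, map_zero, sub_zero] at h1
  exact (Ideal.mul_unit_mem_iff_mem I h2).1 h1

theorem exists_isRegular {I : Ideal PS} (hI : FiniteDimensional ℂ (PS ⧸ I)) :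
    ∃ ν n, IsRegular I 0 ν n := by
  classical
  obtain ⟨n, hn⟩ := exists_X_pow_mem hI 0
  obtain ⟨m, hm⟩ := exists_X_pow_mem hI 1
  have hex : ∃ ν, (0, ν) ∈ expo I := by
    refine ⟨m, _, hm, ?_⟩
    rw [show pt (0, m).1 (0, m).2 = Finsupp.single 1 m by rw [pt_eq_iff]; simp, coeff_X_pow,
      if_pos rfl]
    exact one_ne_zero
  refine ⟨Nat.find hex, n, fun f hf e he => ?_, Nat.find_spec hex, by rwa [zero_add]⟩
  obtain ⟨he0, he1⟩ : e 0 = 0 ∧ e 1 < Nat.find hex := by omega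
  by_contra hne
  refine Nat.find_min hex he1 ⟨f, hf, ?_⟩
  simp only
  rwa [← he0, pt_eta]

end NewtonTree

/-! ### The order as a sum over dicritical vertices -/

theorem mainTheorem10 (I : Ideal NewtonTree.PS)
    (hI : FiniteDimensional ℂ (NewtonTree.PS ⧸ I)) :
    (NewtonTree.dicriticalVertices I).Finite ∧
      IsGreatest {k : ℕ | I ≤ IsLocalRing.maximalIdeal NewtonTree.PS ^ k}
        (∑ᶠ v ∈ NewtonTree.dicriticalVertices I, v.rho * v.d) := by
  classical
  obtain ⟨ν, n, h⟩ := NewtonTree.exists_isRegular hI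
  have hex : ∃ m, ∃ e ∈ NewtonTree.expo I, e.1 + e.2 = m := ⟨_, _, h.mem_expo, rfl⟩
  obtain ⟨m, hm, hm_le⟩ : ∃ m, (∃ e ∈ NewtonTree.expo I, e.1 + e.2 = m) ∧
      ∀ e ∈ NewtonTree.expo I, m ≤ e.1 + e.2 :=
    ⟨Nat.find hex, Nat.find_spec hex, fun e he => Nat.find_min' hex ⟨e, he, rfl⟩⟩
  obtain ⟨D, hD, hsum⟩ : ∃ D : Finset NewtonTree.Vertex,
      (∀ v, v ∈ D ↔ v ∈ NewtonTree.dicriticalVertices I) ∧ ∑ v ∈ D, v.rho * v.d = m := by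
    -- If ν = 0, then I is the unit ideal: the tree is empty and the order is 0.
    rcases Nat.eq_zero_or_pos ν with rfl | hν
    · refine ⟨∅, fun v => ?_, ?_⟩
      · simpa using NewtonTree.not_mem_dicriticalVertices (h.isDepthZero_iff.2 rfl) v
      · have := hm_le _ h.mem_expo
        simp only at this
        simp only [Finset.sum_empty]
        omega
    · obtain ⟨A, hA, -⟩ := h.exists_latticeFaces
      -- The weight min enters only at the first face; the attached trees are counted with the
      -- products of the p's, which add up to their heights.
      obtain ⟨M, D, hM, hD, hg⟩ := NewtonTree.exists_dicriticalVertices h hν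
        (fun _ _ _ _ hL hF => (h.transform hL hF).sum_prodP) A hA
      refine ⟨D, hD, ?_⟩
      have h1 := hg min
      simp only [NewtonTree.Vertex.weight_min] at h1
      rw [h1, h.sum_min_eq hm hm_le hA hM]
  have hDset : NewtonTree.dicriticalVertices I = D := by
    ext v
    rw [Finset.mem_coe, hD]
  rw [hDset, finsum_mem_coe_finset, hsum]
  refine ⟨D.finite_toSet, NewtonTree.le_maximalIdeal_pow_iff.2 hm_le, fun k hk => ?_⟩
  obtain ⟨e, he, rfl⟩ := hm
  exact NewtonTree.le_maximalIdeal_pow_iff.1 hk e he
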